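/- Let $X$ be a smooth affine algebraic variety over an algebraically closed field $k$ of characteristic $0$, with coordinate ring $\mathcal O=\mathcal O_X(X)$ and ring of differential operators $\mathcal D=\mathcal D_X(X)$. Let $\mathcal A$ be a differential non-negatively graded commutative $\mathcal D$-algebra, that is, a commutative monoid in the symmetric monoidal category of non-negatively graded chain complexes of left $\mathcal D$-modules, with the tensor product taken over $\mathcal O$ (vector fields act on a tensor product by the Leibniz rule). Let $\mathrm{Mod}(\mathcal A)$ be the category of $\mathcal A$-modules in this category of complexes, equipped with the following classes of morphisms: weak equivalences are the quasi-isomorphisms, fibrations are the morphisms that are surjective in all positive degrees, and cofibrations are the morphisms that have the left lifting property with respect to all morphisms that are both fibrations and weak equivalences. An object $C$ is cofibrant if $0\to C$ is a cofibration. A Sullivan $\mathcal A$-module is an object of $\mathrm{Mod}(\mathcal A)$ of the form $(\mathcal A\otimes_{\mathcal O}V,d)$, with the natural graded $\mathcal D$-module structure and $\mathcal A$-action, where $V$ is a free non-negatively graded $\mathcal D$-module that admits a homogeneous basis $(m_\alpha)_{\alpha\in I}$ indexed by a well-ordered set $I$ such that $$d\,m_\alpha\in\mathcal A\otimes_{\mathcal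 O}V_{<\alpha},\qquad V_{<\alpha}:=\bigoplus_{\beta<\alpha}\mathcal D\cdot m_\beta ,\qquad\text{for all }\alpha\in I .$$ Theorem. An object of $\mathrm{Mod}(\mathcal A)$ is cofibrant if and only if it is a retract, in $\mathrm{Mod}(\mathcal A)$, of a Sullivan $\mathcal A$-module. -/

import Mathlib

open CategoryTheory CategoryTheory.Limits HomotopicalAlgebra TensorProduct

universe v u

/-! ### The ring of differential operators -/

section DiffOp

variable (k : Type v) (O : Type u) [Field k] [CommRing O] [Algebra k O]

/-- `HasDiffOrder k O n P`: the `k`-linear endomorphism `P` of `O` is a differential operator of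
order at most `n`, i.e. it lies in `F_n`, where `F_{-1} = 0` and
`F_n = {P | [P, f] ∈ F_{n-1} for all f ∈ O}`. -/
def HasDiffOrder : ℕ → Module.End k O → Prop
  | 0, P => ∀ f : O, P * LinearMap.mulLeft k f - LinearMap.mulLeft k f * P = 0
  | n + 1, P => ∀ f : O, HasDiffOrder n (P * LinearMap.mulLeft k f - LinearMap.mulLeft k f * P)

variable {k O}

theorem HasDiffOrder.zero (n : ℕ) : HasDiffOrder k O n 0 := by
  induction n with
  | zero => intro f; simp
  | succ n ih => intro f; simpa using ih

theorem HasDiffOrder.succ {n : ℕ} {P : Module.End k O} (h : HasDiffOrder k O n P) :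
    HasDiffOrder k O (n + 1) P := by
  induction n generalizing P with
  | zero => intro f; rw [h f]; exact HasDiffOrder.zero 0
  | succ n ih => intro f; exact ih (h f)

theorem HasDiffOrder.mono {m n : ℕ} (hmn : m ≤ n) {P : Module.End k O}
    (h : HasDiffOrder k O m P) : HasDiffOrder k O n P := by
  induction hmn with
  | refl => exact h
  | step _ ih => exact ih.succ

theorem HasDiffOrder.add {n : ℕ} {P Q : Module.End k O} (hP : HasDiffOrder k O n P)
    (hQ : HasDiffOrder k O n Q) : HasDiffOrder k O n (P + Q) := by
  induction n generalizing P Q with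
  | zero =>
    intro f
    have e : (P + Q) * LinearMap.mulLeft k f - LinearMap.mulLeft k f * (P + Q)
      = (P * LinearMap.mulLeft k f - LinearMap.mulLeft k f * P)
        + (Q * LinearMap.mulLeft k f - LinearMap.mulLeft k f * Q) := by noncomm_ring
    rw [e, hP f, hQ f, add_zero]
  | succ n ih =>
    intro f
    have e : (P + Q) * LinearMap.mulLeft k f - LinearMap.mulLeft k f * (P + Q)
      = (P * LinearMap.mulLeft k f - LinearMap.mulLeft k f * P)
        + (Q * LinearMap.mulLeft k f - LinearMap.mulLeft k f * Q) := by noncomm_ring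
    rw [e]
    exact ih (hP f) (hQ f)

theorem HasDiffOrder.mul {m n : ℕ} {P Q : Module.End k O} (hP : HasDiffOrder k O m P)
    (hQ : HasDiffOrder k O n Q) : HasDiffOrder k O (m + n) (P * Q) := by
  have key : ∀ (P Q : Module.End k O) (f : O),
      P * Q * LinearMap.mulLeft k f - LinearMap.mulLeft k f * (P * Q)
      = P * (Q * LinearMap.mulLeft k f - LinearMap.mulLeft k f * Q)
        + (P * LinearMap.mulLeft k f - LinearMap.mulLeft k f * P) * Q := by
    intros
    rw [mul_sub, sub_mul]
    simp only [mul_assoc]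
    abel
  induction hN : m + n generalizing m n P Q with
  | zero =>
    obtain ⟨rfl, rfl⟩ : m = 0 ∧ n = 0 := by omega
    intro f
    rw [key, hP f, hQ f]
    simp
  | succ N ih =>
    intro f
    rw [key]
    refine HasDiffOrder.add ?_ ?_
    · cases n with
      | zero => rw [hQ f, mul_zero]; exact HasDiffOrder.zero _
      | succ n => exact ih hP (hQ f) (by omega)
    · cases m with
      | zero => rw [hP f, zero_mul]; exact HasDiffOrder.zero _
      | succ m => exact ih (hP f) hQ (by omega)

theorem hasDiffOrder_mulLeft (f : O) : HasDiffOrder k O 0 (LinearMap.mulLeft k f) := by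
  intro g
  ext x
  simp [mul_left_comm]

theorem hasDiffOrder_derivation (θ : Derivation k O O) :
    HasDiffOrder k O 1 (θ : O →ₗ[k] O) := by
  intro f
  have e : (θ : O →ₗ[k] O) * LinearMap.mulLeft k f - LinearMap.mulLeft k f * (θ : O →ₗ[k] O)
      = LinearMap.mulLeft k (θ f) := by
    ext x
    simp [mul_comm]
  rw [e]
  exact hasDiffOrder_mulLeft (θ f)

variable (k O)

/-- The `k`-algebra of differential operators on `O`, as a subalgebra of `End_k(O)`. -/
def diffOpSubalgebra : Subalgebra k (Module.End k O) where
  carrier := {P | ∃ n, HasDiffOrder k O n P}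
  mul_mem' := by
    rintro P Q ⟨m, hP⟩ ⟨n, hQ⟩
    exact ⟨m + n, hP.mul hQ⟩
  add_mem' := by
    rintro P Q ⟨m, hP⟩ ⟨n, hQ⟩
    exact ⟨max m n, (hP.mono (le_max_left m n)).add (hQ.mono (le_max_right m n))⟩
  algebraMap_mem' := by
    intro c
    refine ⟨0, ?_⟩
    have e : algebraMap k (Module.End k O) c = LinearMap.mulLeft k (algebraMap k O c) := by
      ext x
      simp [Algebra.smul_def]
    rw [e]
    exact hasDiffOrder_mulLeft _

/-- The ring `𝒟` of differential operators on `O`. When `O` is the coordinate ring of an affine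
variety `X`, this is the ring of global sections of the sheaf of differential operators of `X`. -/
def DiffOp : Type u := ↥(diffOpSubalgebra k O)

instance DiffOp.instRing : Ring (DiffOp k O) := inferInstanceAs (Ring ↥(diffOpSubalgebra k O))

instance DiffOp.instAlgebra : Algebra k (DiffOp k O) :=
  inferInstanceAs (Algebra k ↥(diffOpSubalgebra k O))

variable {O}

/-- A function, viewed as the differential operator of multiplication by it. -/
def DiffOp.ofFun : O →+* DiffOp k O where
  toFun f := ⟨LinearMap.mulLeft k f, 0, hasDiffOrder_mulLeft f⟩
  map_one' := Subtype.ext (LinearMap.mulLeft_one k O)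
  map_mul' f g := Subtype.ext (LinearMap.mulLeft_mul k O f g)
  map_zero' := Subtype.ext (LinearMap.mulLeft_zero_eq_zero k O)
  map_add' f g := Subtype.ext (LinearMap.ext fun x => add_mul f g x)

variable {k}

/-- A vector field on `X`, viewed as a differential operator. -/
def DiffOp.ofDer (θ : Derivation k O O) : DiffOp k O :=
  ⟨(θ : O →ₗ[k] O), 1, hasDiffOrder_derivation θ⟩

variable (k O)

/-- `𝒟` as an `O`-module, by multiplication from the left. -/
instance DiffOp.instModuleFun : Module O (DiffOp k O) :=
  Module.compHom (DiffOp k O) (DiffOp.ofFun k)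

instance DiffOp.instIsScalarTowerFun : IsScalarTower O (DiffOp k O) (DiffOp k O) :=
  ⟨fun f P Q => mul_assoc (DiffOp.ofFun k f) P Q⟩

end DiffOp

/-! ### Differential graded `𝒟`-algebras and their modules

Graded objects are written internally, as the direct sum of their homogeneous components.
In `M ⊗_O N`, for left `𝒟`-modules `M` and `N`, vector fields act by the Leibniz rule, so that a
`𝒟`-linear map `M ⊗_O N → P` is an `O`-bilinear map `b` with
`θ • b m n = b (θ • m) n + b m (θ • n)` for all vector fields `θ`. -/

/-- A differential non-negatively graded commutative `𝒟`-algebra, i.e. a commutative monoid in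
the symmetric monoidal category of non-negatively graded chain complexes of left `𝒟`-modules with
tensor product over `O`. -/
structure DGDAlg (k : Type v) (O : Type u) [Field k] [CommRing O] [Algebra k O] where
  carrier : Type u
  [ring : Ring carrier]
  [algebraFun : Algebra O carrier]
  [moduleD : Module (DiffOp k O) carrier]
  /-- The `O`-module structure is the restriction of the `𝒟`-module structure. -/
  [tower : IsScalarTower O (DiffOp k O) carrier]
  /-- The homogeneous components. -/
  gr : ℕ → Submodule (DiffOp k O) carrier
  isInternal : DirectSum.IsInternal gr
  one_mem : (1 : carrier) ∈ gr 0
  mul_mem : ∀ {i j : ℕ} {a b : carrier}, a ∈ gr i → b ∈ gr j → a * b ∈ gr (i + j)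
  mul_comm_of_mem : ∀ {i j : ℕ} {a b : carrier}, a ∈ gr i → b ∈ gr j →
    a * b = (-1 : ℤ) ^ (i * j) • (b * a)
  /-- The multiplication `A ⊗_O A → A` is `𝒟`-linear. -/
  der_mul : ∀ (θ : Derivation k O O) (a b : carrier),
    DiffOp.ofDer θ • (a * b) = (DiffOp.ofDer θ • a) * b + a * (DiffOp.ofDer θ • b)
  /-- The differential, of degree `-1`. -/
  d : carrier →ₗ[DiffOp k O] carrier
  d_mem : ∀ {n : ℕ} {a : carrier}, a ∈ gr (n + 1) → d a ∈ gr n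
  d_of_mem_zero : ∀ {a : carrier}, a ∈ gr 0 → d a = 0
  d_d : ∀ a : carrier, d (d a) = 0
  d_mul : ∀ {i : ℕ} {a : carrier} (b : carrier), a ∈ gr i →
    d (a * b) = d a * b + (-1 : ℤ) ^ i • (a * d b)

attribute [instance] DGDAlg.ring DGDAlg.algebraFun DGDAlg.moduleD DGDAlg.tower

section Modules

variable {k : Type v} {O : Type u} [Field k] [CommRing O] [Algebra k O]

/-- A module over `A` in the category of non-negatively graded chain complexes of left
`𝒟`-modules. -/
structure DGDMod (A : DGDAlg k O) where
  carrier : Type u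
  [addCommGroup : AddCommGroup carrier]
  [moduleFun : Module O carrier]
  [moduleD : Module (DiffOp k O) carrier]
  /-- The `O`-module structure is the restriction of the `𝒟`-module structure. -/
  [towerD : IsScalarTower O (DiffOp k O) carrier]
  /-- The action of the ring underlying `A`. -/
  [moduleA : Module A.carrier carrier]
  /-- The `A`-action is `O`-bilinear. -/
  [towerA : IsScalarTower O A.carrier carrier]
  /-- The homogeneous components. -/
  gr : ℕ → Submodule (DiffOp k O) carrier
  isInternal : DirectSum.IsInternal gr
  smul_mem : ∀ {i j : ℕ} {a : A.carrier} {m : carrier}, a ∈ A.gr i → m ∈ gr j →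
    a • m ∈ gr (i + j)
  /-- The action `A ⊗_O M → M` is `𝒟`-linear. -/
  der_smul : ∀ (θ : Derivation k O O) (a : A.carrier) (m : carrier),
    DiffOp.ofDer θ • (a • m) = (DiffOp.ofDer θ • a) • m + a • (DiffOp.ofDer θ • m)
  /-- The differential, of degree `-1`. -/
  d : carrier →ₗ[DiffOp k O] carrier
  d_mem : ∀ {n : ℕ} {m : carrier}, m ∈ gr (n + 1) → d m ∈ gr n
  d_of_mem_zero : ∀ {m : carrier}, m ∈ gr 0 → d m = 0
  d_d : ∀ m : carrier, d (d m) = 0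
  d_smul : ∀ {i : ℕ} {a : A.carrier} (m : carrier), a ∈ A.gr i →
    d (a • m) = A.d a • m + (-1 : ℤ) ^ i • (a • d m)

attribute [instance] DGDMod.addCommGroup DGDMod.moduleFun DGDMod.moduleD DGDMod.towerD
  DGDMod.moduleA DGDMod.towerA

namespace DGDMod

variable {A : DGDAlg k O}

/-- Morphisms of `A`-modules: `A`- and `𝒟`-linear chain maps of degree `0`. -/
@[ext]
structure Hom (M N : DGDMod A) where
  toLin : M.carrier →ₗ[DiffOp k O] N.carrier
  map_smul : ∀ (a : A.carrier) (m : M.carrier), toLin (a • m) = a • toLin m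
  map_mem : ∀ {n : ℕ} {m : M.carrier}, m ∈ M.gr n → toLin m ∈ N.gr n
  map_d : ∀ m : M.carrier, toLin (M.d m) = N.d (toLin m)

instance : Category (DGDMod A) where
  Hom := Hom
  id M :=
    { toLin := LinearMap.id
      map_smul := fun _ _ => rfl
      map_mem := fun h => h
      map_d := fun _ => rfl }
  comp f g :=
    { toLin := g.toLin ∘ₗ f.toLin
      map_smul := fun a m => by simp [f.map_smul, g.map_smul]
      map_mem := fun h => g.map_mem (f.map_mem h)
      map_d := fun m => by simp [f.map_d, g.map_d] }

variable (A) in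
/-- The zero `A`-module. -/
def zero : DGDMod A where
  carrier := PUnit
  gr _ := ⊤
  isInternal := by
    rw [DirectSum.isInternal_submodule_iff_iSupIndep_and_iSup_eq_top]
    exact ⟨fun i => Submodule.disjoint_def.2 fun x _ _ => Subsingleton.elim (α := PUnit) x 0,
      eq_top_iff.2 fun x _ => by
        rw [Subsingleton.elim (α := PUnit) x 0]; exact Submodule.zero_mem _⟩
  smul_mem _ _ := trivial
  der_smul _ _ _ := rfl
  d := 0
  d_mem _ := trivial
  d_of_mem_zero _ := rfl
  d_d _ := rfl
  d_smul _ _ := rfl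

variable (A) in
/-- The zero `A`-module is an initial object. -/
def zeroIsInitial : IsInitial (zero A) :=
  IsInitial.ofUniqueHom
    (fun M =>
      { toLin := 0
        map_smul := fun a _ => (smul_zero a).symm
        map_mem := fun {n} _ _ => (M.gr n).zero_mem
        map_d := fun _ => (map_zero M.d).symm })
    (fun M f => by
      apply Hom.ext
      ext x
      have hx : x = 0 := Subsingleton.elim (α := PUnit) x 0
      rw [hx, map_zero, map_zero])

instance : HasInitial (DGDMod A) := (zeroIsInitial A).hasInitial

/-- The cycles of `M` (in all degrees). -/
def cycles (M : DGDMod A) : Submodule (DiffOp k O) M.carrier := LinearMap.ker M.d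

/-- The boundaries of `M`, as a submodule of the cycles. -/
def boundaries (M : DGDMod A) : Submodule (DiffOp k O) M.cycles :=
  (LinearMap.range M.d).comap M.cycles.subtype

/-- The homology of `M`: the direct sum of the `𝒟`-modules `H_n(M)`. -/
abbrev Homology (M : DGDMod A) : Type u := M.cycles ⧸ M.boundaries

/-- The map induced on cycles. -/
def mapCycles {M N : DGDMod A} (f : M ⟶ N) : M.cycles →ₗ[DiffOp k O] N.cycles :=
  f.toLin.restrict fun m hm => by
    have hm' : M.d m = 0 := hm
    change N.d (f.toLin m) = 0
    rw [← f.map_d, hm', map_zero]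

/-- The map induced on homology. -/
def mapHomology {M N : DGDMod A} (f : M ⟶ N) : M.Homology →ₗ[DiffOp k O] N.Homology :=
  Submodule.mapQ _ _ (mapCycles f) (by
    rintro ⟨z, hz⟩ ⟨m, hm⟩
    exact ⟨f.toLin m, by rw [← f.map_d, hm]; rfl⟩)

/-- Weak equivalences are the quasi-isomorphisms. -/
instance : CategoryWithWeakEquivalences (DGDMod A) where
  weakEquivalences := fun _ _ f => Function.Bijective (mapHomology f)

/-- Fibrations are the morphisms that are surjective in all positive degrees. -/
instance : CategoryWithFibrations (DGDMod A) where
  fibrations := fun M N f => ∀ n : ℕ, 0 < n → ∀ y ∈ N.gr n, ∃ x ∈ M.gr n, f.toLin x = y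

/-- Cofibrations are the morphisms that have the left lifting property with respect to trivial
fibrations. -/
instance : CategoryWithCofibrations (DGDMod A) where
  cofibrations := (trivialFibrations (DGDMod A)).llp

/-- For a family `m` of elements of an `A`-module `S`, with index set `ι`, and the free `𝒟`-module
`V` with basis `ι`, this is the map `A ⊗_O V → S`, `a ⊗ ∑ Δ_α e_α ↦ a • ∑ Δ_α • m_α`. -/
noncomputable def freeMap (S : DGDMod A) {ι : Type u} (m : ι → S.carrier) :
    A.carrier ⊗[O] (ι →₀ DiffOp k O) →ₗ[O] S.carrier :=
  TensorProduct.lift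
    ((Algebra.lsmul O O S.carrier).toLinearMap.compl₂
      ((Finsupp.linearCombination (DiffOp k O) m).restrictScalars O))

/-- `S` is a Sullivan `A`-module: as a graded `𝒟`-module with `A`-action it is `A ⊗_O V`, where `V`
is a free graded `𝒟`-module with a homogeneous basis `(m_α)` indexed by a well-ordered set, and
`d m_α ∈ A ⊗_O V_{<α}` for all `α`, where `V_{<α}` is the free submodule on the `m_β` with `β < α`.
(The map `freeMap S m` respects the gradings, the `A`-actions, and the actions of functions and
vector fields. So, if it is bijective, it identifies `S` with `A ⊗_O V` as a graded `𝒟`-module with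
`A`-action.) -/
def IsSullivan (S : DGDMod A) : Prop :=
  ∃ (ι : Type u) (_ : LinearOrder ι) (_ : WellFoundedLT ι) (deg : ι → ℕ) (m : ι → S.carrier),
    (∀ α, m α ∈ S.gr (deg α)) ∧
    Function.Bijective (S.freeMap m) ∧
    ∀ α, S.d (m α) ∈ LinearMap.range (S.freeMap fun β : {β : ι // β < α} => m β)

end DGDMod

end Modules

/-!
Over a smooth variety in characteristic zero, functions and vector fields generate `𝒟`, because the
symbol of an operator of order `n` satisfies Euler's formula `n P = ∑ [P, x_j] θ_j` up to lower
order. The same formula shows that `M ⊗_O V`, for `V` a free `𝒟`-module, embeds into a space of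
functions with values in `M`, through evaluation of the operators; the action of `𝒟` on `M ⊗_O V`
is the restriction of the pointwise action.

A morphism is a trivial fibration if and only if it has the lifting property for the inclusions of
spheres into disks: an element over a prescribed `y` and with a prescribed boundary `w` exists
whenever `w` is a cycle of the right degree that lies over `d y`. Hence a morphism out of a Sullivan
module lifts through a trivial fibration by recursion along the basis, the boundary of the lift of
`m_α` being determined by the lifts of the earlier `m_β`, and this property passes to retracts.
Conversely, every `C` is the target of a trivial fibration from a Sullivan module, freely generated
by cells that solve all the disk lifting problems, each with finitely many earlier cells as faces.
If `C` is cofibrant, then this trivial fibration has a section.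
-/

/-! ### Differential operators on a variety with finite projective module of differentials -/

namespace DiffOp

variable {k : Type v} {O : Type u} [Field k] [CommRing O] [Algebra k O]

/-- A differential operator, viewed as an endomorphism of `O`. -/
def toEnd : DiffOp k O →ₐ[k] Module.End k O := (diffOpSubalgebra k O).val

@[ext]
theorem ext {P Q : DiffOp k O} (h : ∀ f, P.toEnd f = Q.toEnd f) : P = Q :=
  Subtype.ext (LinearMap.ext h)

theorem smul_def (f : O) (P : DiffOp k O) : f • P = ofFun k f * P := rfl

@[simp]
theorem toEnd_smul_apply (f y : O) (P : DiffOp k O) : (f • P).toEnd y = f * P.toEnd y := rfl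

@[simp]
theorem toEnd_ofFun_apply (f y : O) : (ofFun k f).toEnd y = f * y := rfl

@[simp]
theorem toEnd_ofDer_apply (θ : Derivation k O O) (y : O) : (ofDer θ).toEnd y = θ y := rfl

instance : IsScalarTower k O (DiffOp k O) :=
  ⟨fun c f P => ext fun y => by
    rw [toEnd_smul_apply, map_smul, LinearMap.smul_apply, toEnd_smul_apply, smul_mul_assoc]⟩

/-- The commutator `P ↦ P f - f P` with a function `f`. -/
def commFun (f : O) : DiffOp k O →ₗ[O] DiffOp k O :=
  LinearMap.mulRight O (ofFun k f) - f • LinearMap.id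

@[simp]
theorem toEnd_commFun_apply (f y : O) (P : DiffOp k O) :
    (commFun f P).toEnd y = P.toEnd (f * y) - f * P.toEnd y := rfl

theorem commFun_comm (f g : O) (P : DiffOp k O) :
    commFun f (commFun g P) = commFun g (commFun f P) := by
  ext y
  simp only [toEnd_commFun_apply, mul_left_comm g f y]
  ring

theorem commFun_mul (f : O) (P Q : DiffOp k O) :
    commFun f (P * Q) = P * commFun f Q + commFun f P * Q := by
  ext y
  simp

theorem commFun_ofDer (f : O) (θ : Derivation k O O) :
    commFun f (ofDer θ) = ofFun k (θ f) := by
  ext y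
  simp [mul_comm]

theorem mul_ofFun (P : DiffOp k O) (f : O) : P * ofFun k f = f • P + commFun f P := by
  ext y
  simp

theorem commFun_mul_left (f g : O) (P : DiffOp k O) :
    commFun (f * g) P = f • commFun g P + g • commFun f P + commFun g (commFun f P) := by
  ext y
  simp only [toEnd_commFun_apply, map_add, LinearMap.add_apply, toEnd_smul_apply, mul_assoc]
  ring

variable (k O) in
/-- The differential operators of order less than `n`. -/
def orderLT : ℕ → Submodule O (DiffOp k O)
  | 0 => ⊥
  | n + 1 => ⨅ f : O, (orderLT n).comap (commFun f)

theorem mem_orderLT_zero {P : DiffOp k O} : P ∈ orderLT k O 0 ↔ P = 0 := Submodule.mem_bot O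

theorem mem_orderLT_succ {n : ℕ} {P : DiffOp k O} :
    P ∈ orderLT k O (n + 1) ↔ ∀ f, commFun f P ∈ orderLT k O n := by
  simp [orderLT, Submodule.mem_iInf]

theorem orderLT_mono : Monotone (orderLT k O) := by
  refine monotone_nat_of_le_succ fun n => ?_
  induction n with
  | zero => exact bot_le
  | succ n ih => exact fun P hP => mem_orderLT_succ.2 fun f => ih (mem_orderLT_succ.1 hP f)

theorem exists_mem_orderLT (P : DiffOp k O) : ∃ n, P ∈ orderLT k O n := by
  obtain ⟨n, hn⟩ := P.2
  refine ⟨n + 1, ?_⟩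
  induction n generalizing P with
  | zero =>
    exact mem_orderLT_succ.2 fun f => mem_orderLT_zero.2 (Subtype.ext (hn f))
  | succ n ih => exact mem_orderLT_succ.2 fun f => ih _ (hn f)

theorem smul_one_eq_of_mem_orderLT_one {P : DiffOp k O} (hP : P ∈ orderLT k O 1) :
    P.toEnd 1 • (1 : DiffOp k O) = P := by
  ext f
  have h : commFun f P = 0 := mem_orderLT_zero.1 (mem_orderLT_succ.1 hP f)
  have hf := toEnd_commFun_apply f 1 P
  rw [h, map_zero, LinearMap.zero_apply, eq_comm, sub_eq_zero, mul_one] at hf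
  simp [hf, mul_comm]

/-- Functions `x_j` and vector fields `θ_j` with `df = ∑ θ_j(f) dx_j` for all functions `f`: they
play the role of local coordinates and of the corresponding partial derivatives. -/
def IsDualFrame {J : Type*} [Fintype J] (x : J → O) (θ : J → Derivation k O O) : Prop :=
  ∀ f : O, KaehlerDifferential.D k O f = ∑ j, θ j f • KaehlerDifferential.D k O (x j)

variable (k O) in
theorem exists_isDualFrame [Module.Finite O Ω[O⁄k]] [Module.Projective O Ω[O⁄k]] :
    ∃ (J : Type u) (_ : Fintype J) (x : J → O) (θ : J → Derivation k O O), IsDualFrame x θ := by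
  have hfin : (⊤ : Submodule O Ω[O⁄k]).FG := Module.Finite.fg_top
  rw [← KaehlerDifferential.span_range_derivation,
    Submodule.fg_span_iff_fg_span_finset_subset] at hfin
  obtain ⟨s, hs, hspan⟩ := hfin
  choose x hx using fun w : s => hs w.2
  have hsurj : Function.Surjective (Fintype.linearCombination O fun w : s => (w : Ω[O⁄k])) := by
    rw [← LinearMap.range_eq_top, Fintype.range_linearCombination, Subtype.range_coe_subtype]
    simpa [KaehlerDifferential.span_range_derivation] using hspan.symm
  obtain ⟨σ, hσ⟩ := Module.projective_lifting_property _ LinearMap.id hsurj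
  refine ⟨s, inferInstance, x,
    fun w => ((LinearMap.proj w).comp σ).compDer (KaehlerDifferential.D k O), fun f => ?_⟩
  simpa [Fintype.linearCombination_apply, hx] using
    (LinearMap.congr_fun hσ (KaehlerDifferential.D k O f)).symm

section DualFrame

variable {J : Type*} [Fintype J] {x : J → O} {θ : J → Derivation k O O}

theorem IsDualFrame.derivation_apply (h : IsDualFrame x θ) {M : Type*} [AddCommGroup M]
    [Module O M] [Module k M] [IsScalarTower k O M] (δ : Derivation k O M) (f : O) :
    δ f = ∑ j, θ j f • δ (x j) := by
  rw [← δ.liftKaehlerDifferential_comp_D f, h f]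
  simp

/-- Modulo operators of order less than `n`, the commutator of `P` with a function is a derivation
in that function. -/
theorem IsDualFrame.commFun_sub_sum_mem_orderLT (h : IsDualFrame x θ) {n : ℕ} {P : DiffOp k O}
    (hP : P ∈ orderLT k O (n + 2)) (f : O) :
    commFun f P - ∑ j, θ j f • commFun (x j) P ∈ orderLT k O n := by
  let L : O →ₗ[k] DiffOp k O ⧸ orderLT k O n :=
    { toFun := fun f => (orderLT k O n).mkQ (commFun f P)
      map_add' := fun f g => by
        rw [← map_add]; congr 1; ext y
        simp only [toEnd_commFun_apply, map_add, LinearMap.add_apply, add_mul]; ring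
      map_smul' := fun c f => by
        have : commFun (c • f) P = c • commFun f P := by
          ext y
          simp [smul_sub]
        rw [this]
        rfl }
  let δ : Derivation k O (DiffOp k O ⧸ orderLT k O n) := Derivation.mk' L fun f g => by
    have hPfg : commFun g (commFun f P) ∈ orderLT k O n :=
      mem_orderLT_succ.1 (mem_orderLT_succ.1 hP f) g
    change (orderLT k O n).mkQ (commFun (f * g) P) = f • (orderLT k O n).mkQ (commFun g P)
      + g • (orderLT k O n).mkQ (commFun f P)
    rw [commFun_mul_left, map_add, map_add, map_smul, map_smul, add_eq_left]
    exact (Submodule.Quotient.mk_eq_zero _).2 hPfg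
  rw [← Submodule.Quotient.mk_eq_zero, Submodule.Quotient.mk_sub, sub_eq_zero,
    ← Submodule.mkQ_apply, ← Submodule.mkQ_apply, map_sum]
  exact h.derivation_apply δ f

/-- Euler's formula for the symbol of a differential operator, a homogeneous polynomial of degree
`n` on the cotangent bundle. -/
theorem IsDualFrame.nsmul_sub_sum_mem_orderLT (h : IsDualFrame x θ) {n : ℕ} {P : DiffOp k O}
    (hP : P ∈ orderLT k O (n + 1)) :
    n • P - ∑ j, commFun (x j) P * ofDer (θ j) ∈ orderLT k O n := by
  induction n generalizing P with
  | zero =>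
    have hcomm : ∀ f, commFun f P = 0 := fun f => mem_orderLT_zero.1 (mem_orderLT_succ.1 hP f)
    simp [hcomm]
  | succ n ih =>
    refine mem_orderLT_succ.2 fun f => ?_
    have hcomm : ∀ j, commFun f (commFun (x j) P * ofDer (θ j)) = commFun (x j) (commFun f P) *
        ofDer (θ j) + θ j f • commFun (x j) P + commFun (θ j f) (commFun (x j) P) := fun j => by
      rw [commFun_mul, commFun_ofDer, mul_ofFun, commFun_comm f]
      abel
    have key : commFun f ((n + 1) • P - ∑ j, commFun (x j) P * ofDer (θ j))
        = (n • commFun f P - ∑ j, commFun (x j) (commFun f P) * ofDer (θ j))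
          + (commFun f P - ∑ j, θ j f • commFun (x j) P)
          - ∑ j, commFun (θ j f) (commFun (x j) P) := by
      simp only [map_sub, map_sum, hcomm, succ_nsmul, map_add, map_nsmul, Finset.sum_add_distrib]
      abel
    rw [key]
    exact sub_mem (add_mem (ih (mem_orderLT_succ.1 hP f)) (h.commFun_sub_sum_mem_orderLT hP f))
      (sum_mem fun j _ => mem_orderLT_succ.1 (mem_orderLT_succ.1 hP _) _)

end DualFrame

theorem algebraMap_inv_smul_nsmul [CharZero k] {M : Type*} [AddCommGroup M] [Module O M] {n : ℕ}
    (hn : n ≠ 0) (a : M) : algebraMap k O (n : k)⁻¹ • n • a = a := by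
  rw [← Nat.cast_smul_eq_nsmul O, smul_smul, ← map_natCast (algebraMap k O), ← map_mul,
    inv_mul_cancel₀ (Nat.cast_ne_zero.2 hn), map_one, one_smul]

variable (k O) in
theorem closure_ofFun_union_ofDer [CharZero k] [Module.Finite O Ω[O⁄k]]
    [Module.Projective O Ω[O⁄k]] :
    Subring.closure (Set.range (ofFun (O := O) k) ∪ Set.range ofDer) = ⊤ := by
  obtain ⟨J, _, x, θ, h⟩ := exists_isDualFrame k O
  set R := Subring.closure (Set.range (ofFun (O := O) k) ∪ Set.range ofDer)
  have ofFun_mem : ∀ f, ofFun k f ∈ R := fun f => Subring.subset_closure (.inl ⟨f, rfl⟩)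
  have ofDer_mem : ∀ θ, ofDer θ ∈ R := fun θ => Subring.subset_closure (.inr ⟨θ, rfl⟩)
  suffices ∀ n, ∀ P ∈ orderLT k O n, P ∈ R from
    eq_top_iff.2 fun P _ => let ⟨n, hn⟩ := P.exists_mem_orderLT; this n P hn
  intro n
  induction n with
  | zero => exact fun P hP => mem_orderLT_zero.1 hP ▸ zero_mem R
  | succ n ih =>
    intro P hP
    rcases eq_or_ne n 0 with rfl | hn
    · rw [← smul_one_eq_of_mem_orderLT_one hP]
      exact mul_mem (ofFun_mem _) (one_mem R)
    · have hnP : n • P ∈ R := sub_add_cancel (n • P) (∑ j, commFun (x j) P * ofDer (θ j)) ▸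
        add_mem (ih _ (h.nsmul_sub_sum_mem_orderLT hP)) (sum_mem fun j _ =>
          mul_mem (ih _ (mem_orderLT_succ.1 hP (x j))) (ofDer_mem (θ j)))
      rw [← algebraMap_inv_smul_nsmul (k := k) (O := O) hn P]
      exact mul_mem (ofFun_mem _) hnP

theorem induction [CharZero k] [Module.Finite O Ω[O⁄k]] [Module.Projective O Ω[O⁄k]]
    {p : DiffOp k O → Prop} (ofFun : ∀ f : O, p (DiffOp.ofFun k f))
    (ofDer : ∀ θ : Derivation k O O, p (DiffOp.ofDer θ))
    (add : ∀ P Q, p P → p Q → p (P + Q)) (mul : ∀ P Q, p P → p Q → p (P * Q))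
    (P : DiffOp k O) : p P := by
  have hP : P ∈ Subring.closure (Set.range (DiffOp.ofFun (O := O) k) ∪ Set.range DiffOp.ofDer) :=
    closure_ofFun_union_ofDer k O ▸ Subring.mem_top P
  induction hP using Subring.closure_induction with
  | mem P h => rcases h with ⟨f, rfl⟩ | ⟨θ, rfl⟩; exacts [ofFun f, ofDer θ]
  | zero => simpa using ofFun 0
  | one => simpa using ofFun 1
  | add P Q _ _ hP hQ => exact add P Q hP hQ
  | neg P _ hP => simpa using mul _ _ (ofFun (-1)) hP
  | mul P Q _ _ hP hQ => exact mul P Q hP hQ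

section Evaluation

variable {M : Type*} [AddCommGroup M] [Module O M]

/-- Evaluation at a function. -/
def evalAt (f : O) : DiffOp k O →ₗ[O] O where
  toFun P := P.toEnd f
  map_add' _ _ := by simp
  map_smul' _ _ := by simp

variable (k O M) in
/-- The map `M ⊗_O 𝒟 → (O → M)`, `a ⊗ P ↦ (f ↦ P(f) a)`. -/
noncomputable def evalTensor : M ⊗[O] DiffOp k O →ₗ[O] (O → M) :=
  LinearMap.pi fun f => TensorProduct.lift ((LinearMap.lsmul O M).flip.compl₂ (evalAt f))

@[simp]
theorem evalTensor_tmul (a : M) (P : DiffOp k O) (f : O) :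
    evalTensor k O M (a ⊗ₜ P) f = P.toEnd f • a := rfl

theorem evalTensor_tmul_commFun (x : O) (a : M) (P : DiffOp k O) :
    evalTensor k O M (a ⊗ₜ commFun x P) =
      (LinearMap.funLeft O M (x * ·) - x • .id : (O → M) →ₗ[O] O → M)
        (evalTensor k O M (a ⊗ₜ P)) := by
  ext f
  simp [LinearMap.funLeft_apply, sub_smul, mul_smul]

theorem evalTensor_tmul_mul_ofDer (θ : Derivation k O O) (a : M) (P : DiffOp k O) :
    evalTensor k O M (a ⊗ₜ (P * ofDer θ)) =
      LinearMap.funLeft O M θ (evalTensor k O M (a ⊗ₜ P)) := by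
  ext f
  simp [LinearMap.funLeft_apply]

variable (k M) in
theorem exists_leftInverse_evalTensor_tmul [CharZero k] [Module.Finite O Ω[O⁄k]]
    [Module.Projective O Ω[O⁄k]] (n : ℕ) :
    ∃ Ψ : (O → M) →ₗ[O] M ⊗[O] DiffOp k O, ∀ a, ∀ P ∈ orderLT k O n,
      Ψ (evalTensor k O M (a ⊗ₜ P)) = a ⊗ₜ P := by
  obtain ⟨J, _, x, θ, h⟩ := exists_isDualFrame k O
  induction n with
  | zero => exact ⟨0, fun a P hP => by simp [mem_orderLT_zero.1 hP]⟩
  | succ n ih =>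
    rcases eq_or_ne n 0 with rfl | hn
    · refine ⟨(TensorProduct.mk O M (DiffOp k O)).flip 1 ∘ₗ LinearMap.proj 1, fun a P hP => ?_⟩
      conv_rhs => rw [← smul_one_eq_of_mem_orderLT_one hP]
      simp
    · obtain ⟨Ψ, hΨ⟩ := ih
      let B (j : J) : (O → M) →ₗ[O] (O → M) := LinearMap.funLeft O M (x j * ·) - x j • .id
      let E : (O → M) →ₗ[O] (O → M) := ∑ j, LinearMap.funLeft O M (θ j) ∘ₗ B j
      -- Euler's formula expresses `n • P` through operators of lower order and the `θ j`.
      refine ⟨algebraMap k O (n : k)⁻¹ • (Ψ ∘ₗ (n • .id - E) +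
        ∑ j, (LinearMap.mulRight O (ofDer (θ j))).lTensor M ∘ₗ Ψ ∘ₗ B j), fun a P hP => ?_⟩
      have hB (j) : Ψ (B j (evalTensor k O M (a ⊗ₜ P))) = a ⊗ₜ commFun (x j) P := by
        rw [← evalTensor_tmul_commFun, hΨ a _ (mem_orderLT_succ.1 hP _)]
      have hE : (n • .id - E : (O → M) →ₗ[O] (O → M)) (evalTensor k O M (a ⊗ₜ P)) =
          evalTensor k O M (a ⊗ₜ (n • P - ∑ j, commFun (x j) P * ofDer (θ j))) := by
        simp [E, B, tmul_sub, tmul_sum, -nsmul_eq_mul,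
          evalTensor_tmul_mul_ofDer, evalTensor_tmul_commFun]
      simp only [LinearMap.smul_apply, LinearMap.add_apply, LinearMap.comp_apply,
        LinearMap.sum_apply, hB, hE, hΨ a _ (h.nsmul_sub_sum_mem_orderLT hP),
        LinearMap.lTensor_tmul, LinearMap.mulRight_apply, ← tmul_sum, ← tmul_add, sub_add_cancel,
        ← tmul_smul, algebraMap_inv_smul_nsmul hn]

variable (k M) in
theorem evalTensor_injective [CharZero k] [Module.Finite O Ω[O⁄k]]
    [Module.Projective O Ω[O⁄k]] : Function.Injective (evalTensor k O M) := by
  choose Ψ hΨ using fun n => exists_leftInverse_evalTensor_tmul (O := O) k M n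
  have key (t : M ⊗[O] DiffOp k O) : ∃ N, ∀ n ≥ N, Ψ n (evalTensor k O M t) = t := by
    induction t with
    | zero => exact ⟨0, by simp⟩
    | tmul a P =>
      obtain ⟨N, hN⟩ := P.exists_mem_orderLT
      exact ⟨N, fun n hn => hΨ n a P (orderLT_mono hn hN)⟩
    | add s t hs ht =>
      obtain ⟨m, hm⟩ := hs
      obtain ⟨n, hn⟩ := ht
      refine ⟨max m n, fun N hN => ?_⟩
      rw [map_add, map_add, hm N (le_of_max_le_left hN), hn N (le_of_max_le_right hN)]
  refine fun s t hst => ?_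
  obtain ⟨m, hm⟩ := key s
  obtain ⟨n, hn⟩ := key t
  rw [← hm _ (le_max_left m n), hst, hn _ (le_max_right m n)]

end Evaluation

end DiffOp

/-! ### Tensor products with free `𝒟`-modules -/

section FreeTensor

variable {k : Type v} {O : Type u} [Field k] [CommRing O] [Algebra k O]

section DModule

variable {M N K : Type*} [AddCommGroup M] [Module O M] [Module (DiffOp k O) M]
  [AddCommGroup N] [Module O N] [Module (DiffOp k O) N]
  [AddCommGroup K] [Module O K] [Module (DiffOp k O) K]

theorem DiffOp.ofFun_smul [IsScalarTower O (DiffOp k O) M] (f : O) (m : M) :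
    DiffOp.ofFun k f • m = f • m := by
  rw [← mul_one (DiffOp.ofFun k f), ← DiffOp.smul_def, smul_assoc, one_smul]

theorem DiffOp.ofDer_smul_smul [IsScalarTower O (DiffOp k O) M] (θ : Derivation k O O) (f : O)
    (m : M) :
    DiffOp.ofDer θ • f • m = f • DiffOp.ofDer θ • m + θ f • m := by
  rw [← DiffOp.ofFun_smul (k := k) f, smul_smul, DiffOp.mul_ofFun, DiffOp.commFun_ofDer,
    add_smul, smul_assoc, DiffOp.ofFun_smul]

variable (k) in
/-- An `O`-bilinear map of `𝒟`-modules on which vector fields act by the Leibniz rule, so that it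
corresponds to a `𝒟`-linear map on the tensor product. -/
def IsLeibniz (b : M →ₗ[O] N →ₗ[O] K) : Prop :=
  ∀ (θ : Derivation k O O) (m : M) (n : N),
    DiffOp.ofDer θ • b m n = b (DiffOp.ofDer θ • m) n + b m (DiffOp.ofDer θ • n)

theorem IsLeibniz.add {b c : M →ₗ[O] N →ₗ[O] K} (hb : IsLeibniz k b)
    (hc : IsLeibniz k c) : IsLeibniz k (b + c) := fun θ m n => by
  simp only [LinearMap.add_apply, smul_add, hb θ, hc θ]
  abel

theorem IsLeibniz.compl₁₂ [IsScalarTower O (DiffOp k O) M] [IsScalarTower O (DiffOp k O) N]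
    {M' N' : Type*} [AddCommGroup M'] [Module O M'] [Module (DiffOp k O) M']
    [IsScalarTower O (DiffOp k O) M'] [AddCommGroup N'] [Module O N'] [Module (DiffOp k O) N']
    [IsScalarTower O (DiffOp k O) N'] {b : M →ₗ[O] N →ₗ[O] K} (hb : IsLeibniz k b)
    (f : M' →ₗ[DiffOp k O] M) (g : N' →ₗ[DiffOp k O] N) :
    IsLeibniz k (b.compl₁₂ (f.restrictScalars O) (g.restrictScalars O)) := fun θ m n => by
  simp [hb θ]

variable [CharZero k] [Module.Finite O Ω[O⁄k]] [Module.Projective O Ω[O⁄k]]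
  [IsScalarTower O (DiffOp k O) N]

theorem IsLeibniz.apply_mem_of_mem_span [IsScalarTower O (DiffOp k O) K]
    {b : M →ₗ[O] N →ₗ[O] K} (hb : IsLeibniz k b)
    {W : Submodule (DiffOp k O) M} {s : Set N} {T : Submodule (DiffOp k O) K}
    (h : ∀ m ∈ W, ∀ n ∈ s, b m n ∈ T) {n : N} (hn : n ∈ Submodule.span (DiffOp k O) s) :
    ∀ m ∈ W, b m n ∈ T := by
  induction hn using Submodule.span_induction with
  | mem n hn => exact fun m hm => h m hm n hn
  | zero => simp
  | add n n' _ _ hn hn' => exact fun m hm => map_add (b m) n n' ▸ add_mem (hn m hm) (hn' m hm)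
  | smul P n _ hn =>
    induction P using DiffOp.induction generalizing n with
    | ofFun f =>
      intro m hm
      rw [DiffOp.ofFun_smul, map_smul, ← DiffOp.ofFun_smul (k := k)]
      exact T.smul_mem _ (hn m hm)
    | ofDer θ =>
      intro m hm
      rw [← add_sub_cancel_left (b (DiffOp.ofDer θ • m) n) (b m (DiffOp.ofDer θ • n)), ← hb]
      exact sub_mem (T.smul_mem _ (hn m hm)) (hn _ (W.smul_mem _ hm))
    | add P Q hP hQ =>
      intro m hm
      rw [add_smul, map_add]
      exact add_mem (hP n ‹_› hn m hm) (hQ n ‹_› hn m hm)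
    | mul P Q hP hQ =>
      rw [mul_smul]
      exact hP _ (Submodule.smul_mem _ _ ‹_›) (hQ n ‹_› hn)

variable [IsScalarTower O (DiffOp k O) M]

/-- An `O`-linear map that is compatible with vector fields is `𝒟`-linear. -/
def DiffOp.linearMapOfDer (h : M →ₗ[O] N)
    (hθ : ∀ (θ : Derivation k O O) (m : M), h (DiffOp.ofDer θ • m) = DiffOp.ofDer θ • h m) :
    M →ₗ[DiffOp k O] N where
  __ := h
  map_smul' P m := by
    induction P using DiffOp.induction generalizing m with
    | ofFun f => simp [DiffOp.ofFun_smul]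
    | ofDer θ => exact hθ θ m
    | add P Q hP hQ => simp_all [add_smul]
    | mul P Q hP hQ => simp_all [mul_smul]

end DModule

variable (k O) in
/-- The tensor product over `O` of a `𝒟`-module `M` and the free `𝒟`-module with basis `ι`. -/
abbrev FreeTensor (M ι : Type*) [AddCommGroup M] [Module O M] : Type _ :=
  M ⊗[O] (ι →₀ DiffOp k O)

variable (k O) in
/-- The map `M ⊗_O V → (ι → O → M)`, `a ⊗ ∑ P_i e_i ↦ (f ↦ P_i(f) a)_i`, where `V` is free on
`ι`. -/
noncomputable def evalFree (M ι : Type*) [AddCommGroup M] [Module O M] :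
    FreeTensor k O M ι →ₗ[O] ι → O → M :=
  LinearMap.pi fun i => DiffOp.evalTensor k O M ∘ₗ LinearMap.lTensor M (Finsupp.lapply i)

namespace FreeTensor

variable {M ι : Type*} [AddCommGroup M] [Module O M]

@[simp]
theorem evalFree_tmul (a : M) (w : ι →₀ DiffOp k O) (i : ι) (f : O) :
    evalFree k O M ι (a ⊗ₜ w) i f = (w i).toEnd f • a := rfl

variable [CharZero k] [Module.Finite O Ω[O⁄k]] [Module.Projective O Ω[O⁄k]]

theorem evalFree_injective : Function.Injective (evalFree k O M ι) := by
  classical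
  rw [injective_iff_map_eq_zero]
  refine fun t ht => (TensorProduct.finsuppRight O O M (DiffOp k O) ι).injective ?_
  ext i
  rw [TensorProduct.finsuppRight_apply, map_zero, Finsupp.zero_apply]
  exact (injective_iff_map_eq_zero _).1 (DiffOp.evalTensor_injective k M) _ (congrFun ht i)

variable [Module (DiffOp k O) M] [IsScalarTower O (DiffOp k O) M]

omit [CharZero k] [Module.Finite O Ω[O⁄k]] [Module.Projective O Ω[O⁄k]] in
theorem evalFree_ofDer_tmul (θ : Derivation k O O) (a : M) (w : ι →₀ DiffOp k O) :
    evalFree k O M ι ((DiffOp.ofDer θ • a) ⊗ₜ w + a ⊗ₜ (DiffOp.ofDer θ • w)) =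
      DiffOp.ofDer θ • evalFree k O M ι (a ⊗ₜ w) := by
  ext i f
  simp [DiffOp.ofDer_smul_smul]

theorem exists_evalFree_eq_smul (P : DiffOp k O) (t : FreeTensor k O M ι) :
    ∃ t', evalFree k O M ι t' = P • evalFree k O M ι t := by
  induction P using DiffOp.induction generalizing t with
  | ofFun f => exact ⟨f • t, by rw [DiffOp.ofFun_smul, map_smul]⟩
  | ofDer θ =>
    induction t using TensorProduct.induction_on with
    | zero => exact ⟨0, by simp⟩
    | tmul a w => exact ⟨_, evalFree_ofDer_tmul θ a w⟩
    | add s t hs ht =>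
      obtain ⟨s', hs⟩ := hs
      obtain ⟨t', ht⟩ := ht
      exact ⟨s' + t', by rw [map_add, map_add, smul_add, hs, ht]⟩
  | add P Q hP hQ =>
    obtain ⟨s, hs⟩ := hP t
    obtain ⟨s', hs'⟩ := hQ t
    exact ⟨s + s', by rw [map_add, hs, hs', add_smul]⟩
  | mul P Q hP hQ =>
    obtain ⟨s, hs⟩ := hQ t
    obtain ⟨s', hs'⟩ := hP s
    exact ⟨s', by rw [hs', hs, mul_smul]⟩

/-- The action of `𝒟` on `M ⊗_O V` in which vector fields act by the Leibniz rule, as the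
restriction of the pointwise action on functions with values in `M`. -/
noncomputable instance : SMul (DiffOp k O) (FreeTensor k O M ι) where
  smul P t := (exists_evalFree_eq_smul P t).choose

theorem evalFree_smul (P : DiffOp k O) (t : FreeTensor k O M ι) :
    evalFree k O M ι (P • t) = P • evalFree k O M ι t :=
  (exists_evalFree_eq_smul P t).choose_spec

noncomputable instance : Module (DiffOp k O) (FreeTensor k O M ι) :=
  evalFree_injective.module _ (evalFree k O M ι).toAddMonoidHom evalFree_smul

instance : IsScalarTower O (DiffOp k O) (FreeTensor k O M ι) where
  smul_assoc f P t := evalFree_injective (by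
    rw [evalFree_smul, map_smul, evalFree_smul, smul_assoc])

theorem ofDer_smul_tmul (θ : Derivation k O O) (a : M) (w : ι →₀ DiffOp k O) :
    DiffOp.ofDer θ • (a ⊗ₜ w : FreeTensor k O M ι) =
      (DiffOp.ofDer θ • a) ⊗ₜ w + a ⊗ₜ (DiffOp.ofDer θ • w) :=
  evalFree_injective (by rw [evalFree_smul, evalFree_ofDer_tmul])

theorem isLeibniz_mk : IsLeibniz k (TensorProduct.mk O M (ι →₀ DiffOp k O)) :=
  ofDer_smul_tmul

theorem span_tmul_single_eq_top :
    Submodule.span (DiffOp k O)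
      {t : FreeTensor k O M ι | ∃ a i, a ⊗ₜ Finsupp.single i 1 = t} = ⊤ := by
  rw [eq_top_iff]
  rintro t -
  induction t using TensorProduct.induction_on with
  | zero => exact zero_mem _
  | add s t hs ht => exact add_mem hs ht
  | tmul a w =>
    refine isLeibniz_mk.apply_mem_of_mem_span (W := ⊤) (s := Set.range fun i => .single i 1)
      ?_ ?_ a trivial
    · rintro a - _ ⟨i, rfl⟩
      exact Submodule.subset_span ⟨a, i, rfl⟩
    · rw [← Finsupp.coe_basisSingleOne, Finsupp.basisSingleOne.span_eq]
      trivial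

/-- The coordinates `evalFree · i f`, which are `𝒟`-linear. -/
noncomputable def coord (i : ι) (f : O) : FreeTensor k O M ι →ₗ[DiffOp k O] M where
  toFun t := evalFree k O M ι t i f
  map_add' s t := by rw [map_add, Pi.add_apply, Pi.add_apply]
  map_smul' P t := by rw [evalFree_smul, Pi.smul_apply, Pi.smul_apply, RingHom.id_apply]

@[simp]
theorem coord_tmul (i : ι) (f : O) (a : M) (w : ι →₀ DiffOp k O) :
    coord i f (a ⊗ₜ w : FreeTensor k O M ι) = (w i).toEnd f • a := rfl

theorem eq_zero_of_coord_eq_zero {t : FreeTensor k O M ι} (h : ∀ i f, coord i f t = 0) : t = 0 :=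
  evalFree_injective (by rw [map_zero]; ext i f; exact h i f)

variable {K : Type*} [AddCommGroup K] [Module O K] [Module (DiffOp k O) K]
  [IsScalarTower O (DiffOp k O) K]

omit [Module O K] [IsScalarTower O (DiffOp k O) K] in
theorem hom_ext {φ ψ : FreeTensor k O M ι →ₗ[DiffOp k O] K}
    (h : ∀ a i, φ (a ⊗ₜ Finsupp.single i 1) = ψ (a ⊗ₜ Finsupp.single i 1)) : φ = ψ :=
  LinearMap.ext_on span_tmul_single_eq_top (by rintro _ ⟨a, i, rfl⟩; exact h a i)

/-- The `𝒟`-linear map on `M ⊗_O V` given by a bilinear map that satisfies the Leibniz rule. -/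
noncomputable def lift {b : M →ₗ[O] (ι →₀ DiffOp k O) →ₗ[O] K} (hb : IsLeibniz k b) :
    FreeTensor k O M ι →ₗ[DiffOp k O] K :=
  DiffOp.linearMapOfDer (TensorProduct.lift b) fun θ t => by
    induction t using TensorProduct.induction_on with
    | zero => simp
    | tmul a w => simp [ofDer_smul_tmul, hb θ]
    | add s t hs ht => rw [smul_add, map_add, hs, ht, map_add, smul_add]

end FreeTensor

end FreeTensor

/-! ### Gradings -/

section Grading

variable {ι R M N : Type*} [Semiring R] [AddCommMonoid M] [Module R M] [AddCommMonoid N]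
  [Module R N]

section Projection

variable [DecidableEq ι] (gr : ι → Submodule R M) [DirectSum.Decomposition gr]

/-- The projection of a graded module to its homogeneous component of degree `n`. -/
def gradedProj (n : ι) : M →ₗ[R] M :=
  (gr n).subtype ∘ₗ DirectSum.component R ι (fun i => gr i) n ∘ₗ
    (DirectSum.decomposeLinearEquiv gr).toLinearMap

variable {gr}

theorem gradedProj_mem (n : ι) (x : M) : gradedProj gr n x ∈ gr n := Subtype.property _

theorem gradedProj_of_mem {n : ι} {x : M} (hx : x ∈ gr n) : gradedProj gr n x = x :=
  DirectSum.decompose_of_mem_same gr hx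

theorem gradedProj_of_mem_ne {m n : ι} {x : M} (hx : x ∈ gr m) (h : m ≠ n) :
    gradedProj gr n x = 0 :=
  DirectSum.decompose_of_mem_ne gr hx h

theorem mem_of_gradedProj_mem {T : Submodule R M} {x : M} (h : ∀ n, gradedProj gr n x ∈ T) :
    x ∈ T := by
  classical
  rw [← DirectSum.sum_support_decompose gr x]
  exact sum_mem fun n _ => h n

variable {gr' : ι → Submodule R N} [DirectSum.Decomposition gr'] {f : M →ₗ[R] N}

theorem map_gradedProj (hf : ∀ n, ∀ x ∈ gr n, f x ∈ gr' n) (n : ι) (x : M) :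
    f (gradedProj gr n x) = gradedProj gr' n (f x) := by
  suffices f ∘ₗ gradedProj gr n = gradedProj gr' n ∘ₗ f from LinearMap.congr_fun this x
  refine DirectSum.decompose_lhom_ext gr fun m => LinearMap.ext fun ⟨x, hx⟩ => ?_
  rcases eq_or_ne m n with rfl | hmn
  · simp [gradedProj_of_mem hx, gradedProj_of_mem (hf m x hx)]
  · simp [gradedProj_of_mem_ne hx hmn, gradedProj_of_mem_ne (hf m x hx) hmn]

theorem mem_of_map_mem (hf : ∀ n, ∀ x ∈ gr n, f x ∈ gr' n) (hinj : Function.Injective f) {n : ι}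
    {x : M} (hx : f x ∈ gr' n) : x ∈ gr n := by
  have h : gradedProj gr n x = x := hinj (by rw [map_gradedProj hf, gradedProj_of_mem hx])
  exact h ▸ gradedProj_mem n x

end Projection

theorem iSupIndep_of_forall_map_le {J : Type*} {gr : ι → Submodule R M}
    {gr' : J → ι → Submodule R N} (hgr' : ∀ j, iSupIndep (gr' j)) (f : J → M →ₗ[R] N)
    (hinj : ∀ x, (∀ j, f j x = 0) → x = 0) (hf : ∀ j n, (gr n).map (f j) ≤ gr' j n) :
    iSupIndep gr := by
  refine fun n => Submodule.disjoint_def.2 fun x hx hx' => hinj x fun j => ?_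
  refine Submodule.disjoint_def.1 (hgr' j n) _ (hf j n (Submodule.mem_map_of_mem hx)) ?_
  have hle : (⨆ m, ⨆ _ : m ≠ n, gr m).map (f j) ≤ ⨆ m, ⨆ _ : m ≠ n, gr' j m := by
    simp only [Submodule.map_iSup]
    exact iSup₂_mono fun m _ => hf j m
  exact hle (Submodule.mem_map_of_mem hx')

section Shift

/-- The grading `gr`, shifted up by `l`. It is zero in degrees below `l`. -/
def shiftGr (l : ℕ) (gr : ℕ → Submodule R M) (n : ℕ) : Submodule R M :=
  if l ≤ n then gr (n - l) else ⊥

variable {l n : ℕ} {gr : ℕ → Submodule R M}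

@[simp]
theorem shiftGr_add_left (l n : ℕ) (gr : ℕ → Submodule R M) : shiftGr l gr (l + n) = gr n := by
  simp [shiftGr]

theorem shiftGr_one_zero : shiftGr 1 gr 0 = ⊥ := rfl

theorem shiftGr_one_succ : shiftGr 1 gr (n + 1) = gr n := by simp [shiftGr]

theorem mem_shiftGr {x : M} : x ∈ shiftGr l gr n ↔ x = 0 ∨ ∃ m, l + m = n ∧ x ∈ gr m := by
  constructor
  · rcases le_or_gt l n with h | h
    · obtain ⟨m, rfl⟩ := Nat.exists_eq_add_of_le h
      exact fun hx => .inr ⟨m, rfl, by rwa [shiftGr_add_left] at hx⟩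
    · exact fun hx => .inl (by simpa [shiftGr, h.not_ge] using hx)
  · rintro (rfl | ⟨m, rfl, hx⟩)
    exacts [zero_mem _, by rwa [shiftGr_add_left]]

theorem map_mem_shiftGr {F : Type*} [FunLike F M N] [ZeroHomClass F M N]
    {gr' : ℕ → Submodule R N} {f : F} {i : ℕ} (hf : ∀ m, ∀ x ∈ gr m, f x ∈ gr' (i + m)) {x : M}
    (hx : x ∈ shiftGr l gr n) : f x ∈ shiftGr l gr' (i + n) := by
  rw [mem_shiftGr] at hx ⊢
  rcases hx with rfl | ⟨m, rfl, hx⟩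
  exacts [.inl (map_zero f), .inr ⟨i + m, by omega, hf m x hx⟩]

theorem iSupIndep_shiftGr (h : iSupIndep gr) (l : ℕ) : iSupIndep (shiftGr l gr) := by
  intro n
  rcases le_or_gt l n with hn | hn
  · obtain ⟨n, rfl⟩ := Nat.exists_eq_add_of_le hn
    rw [shiftGr_add_left]
    refine (h n).mono_right (iSup₂_le fun m hm x hx => ?_)
    rcases mem_shiftGr.1 hx with rfl | ⟨j, rfl, hxj⟩
    exacts [zero_mem _, Submodule.mem_iSup_of_mem j
      (Submodule.mem_iSup_of_mem (ne_of_apply_ne (l + ·) hm) hxj)]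
  · simp [shiftGr, hn.not_ge]

end Shift

end Grading

namespace DGDAlg

variable {k : Type v} {O : Type u} [Field k] [CommRing O] [Algebra k O] (A : DGDAlg k O)

noncomputable instance : DirectSum.Decomposition A.gr := A.isInternal.chooseDecomposition

theorem d_mem_shiftGr {n : ℕ} {a : A.carrier} (ha : a ∈ A.gr n) : A.d a ∈ shiftGr 1 A.gr n := by
  cases n with
  | zero => exact A.d_of_mem_zero ha ▸ zero_mem _
  | succ n => exact mem_shiftGr.2 (.inr ⟨n, by omega, A.d_mem ha⟩)

theorem d_one : A.d 1 = 0 := A.d_of_mem_zero A.one_mem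

/-- The automorphism of `A` that is `(-1)^n` in degree `n`. It is the sign in the Leibniz rule for
`d`. -/
noncomputable def sign : A.carrier →ₗ[DiffOp k O] A.carrier :=
  DirectSum.toModule (DiffOp k O) ℕ A.carrier (fun n => (-1 : ℤ) ^ n • (A.gr n).subtype) ∘ₗ
    (DirectSum.decomposeLinearEquiv A.gr).toLinearMap

variable {A}

theorem sign_of_mem {n : ℕ} {a : A.carrier} (ha : a ∈ A.gr n) :
    A.sign a = (-1 : ℤ) ^ n • a := by
  rw [sign, LinearMap.comp_apply, LinearEquiv.coe_coe, DirectSum.decomposeLinearEquiv_apply,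
    DirectSum.decompose_of_mem A.gr ha]
  exact DirectSum.toModule_lof (DiffOp k O) n _

theorem sign_smul_of_mem {M : Type*} [AddCommGroup M] [Module A.carrier M] {n : ℕ} {a : A.carrier}
    (ha : a ∈ A.gr n) (x : M) : A.sign a • x = (-1 : ℤ) ^ n • a • x := by
  rw [sign_of_mem ha, smul_assoc]

theorem sign_mem {n : ℕ} {a : A.carrier} (ha : a ∈ A.gr n) : A.sign a ∈ A.gr n :=
  sign_of_mem ha ▸ zsmul_mem ha _

theorem sign_one : A.sign 1 = 1 := by simp [sign_of_mem A.one_mem]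

@[elab_as_elim]
theorem homogeneous_induction {p : A.carrier → Prop} (a : A.carrier)
    (mem : ∀ n, ∀ a ∈ A.gr n, p a) (add : ∀ a b, p a → p b → p (a + b)) : p a :=
  DirectSum.Decomposition.inductionOn A.gr (mem 0 0 (zero_mem _)) (fun a => mem _ a a.2) add a

theorem sign_mul (a b : A.carrier) : A.sign (a * b) = A.sign a * A.sign b := by
  induction a using homogeneous_induction with
  | add a a' ha ha' => simp only [add_mul, map_add, ha, ha']
  | mem i a ha =>
    induction b using homogeneous_induction with
    | add b b' hb hb' => simp only [mul_add, map_add, hb, hb']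
    | mem j b hb =>
      rw [sign_of_mem ha, sign_of_mem hb, sign_of_mem (A.mul_mem ha hb), smul_mul_smul_comm,
        pow_add]

theorem d_sign (a : A.carrier) : A.d (A.sign a) = -A.sign (A.d a) := by
  induction a using homogeneous_induction with
  | add a b ha hb => simp only [map_add, ha, hb, neg_add]
  | mem n a ha =>
    rw [sign_of_mem ha, map_zsmul]
    cases n with
    | zero => simp [A.d_of_mem_zero ha]
    | succ n => simp [sign_of_mem (A.d_mem ha), pow_succ]

theorem d_mul' (a b : A.carrier) : A.d (a * b) = A.d a * b + A.sign a * A.d b := by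
  induction a using homogeneous_induction with
  | add a a' ha ha' => simp only [add_mul, map_add, ha, ha']; abel
  | mem i a ha => rw [A.d_mul b ha, sign_of_mem ha, smul_mul_assoc]

end DGDAlg

namespace DGDMod

variable {k : Type v} {O : Type u} [Field k] [CommRing O] [Algebra k O] {A : DGDAlg k O}
  {M N : DGDMod A}

noncomputable instance : DirectSum.Decomposition M.gr := M.isInternal.chooseDecomposition

theorem d_mem_shiftGr {n : ℕ} {x : M.carrier} (hx : x ∈ M.gr n) : M.d x ∈ shiftGr 1 M.gr n := by
  cases n with
  | zero => exact M.d_of_mem_zero hx ▸ zero_mem _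
  | succ n => exact mem_shiftGr.2 (.inr ⟨n, by omega, M.d_mem hx⟩)

theorem d_smul' (a : A.carrier) (x : M.carrier) : M.d (a • x) = A.d a • x + A.sign a • M.d x := by
  induction a using DGDAlg.homogeneous_induction with
  | add a b ha hb => simp only [add_smul, map_add, ha, hb]; abel
  | mem i a ha => rw [M.d_smul x ha, DGDAlg.sign_smul_of_mem ha]

theorem map_gradedProj (f : M ⟶ N) (n : ℕ) (x : M.carrier) :
    f.toLin (gradedProj M.gr n x) = gradedProj N.gr n (f.toLin x) :=
  _root_.map_gradedProj (fun _ _ hx => f.map_mem hx) n x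

theorem d_gradedProj_zero (x : M.carrier) : M.d (gradedProj M.gr 0 x) = 0 :=
  M.d_of_mem_zero (gradedProj_mem 0 x)

theorem d_gradedProj_succ (n : ℕ) (x : M.carrier) :
    M.d (gradedProj M.gr (n + 1) x) = gradedProj M.gr n (M.d x) := by
  suffices M.d ∘ₗ gradedProj M.gr (n + 1) = gradedProj M.gr n ∘ₗ M.d from
    LinearMap.congr_fun this x
  refine DirectSum.decompose_lhom_ext M.gr fun m => LinearMap.ext fun ⟨x, hx⟩ => ?_
  rcases eq_or_ne m (n + 1) with rfl | hmn
  · simp [gradedProj_of_mem hx, gradedProj_of_mem (M.d_mem hx)]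
  · suffices gradedProj M.gr n (M.d x) = 0 by simp [gradedProj_of_mem_ne hx hmn, this]
    rcases mem_shiftGr.1 (M.d_mem_shiftGr hx) with hdx | ⟨j, rfl, hdx⟩
    exacts [by rw [hdx, map_zero], gradedProj_of_mem_ne hdx (by omega)]

theorem d_gradedProj_of_d_mem_shiftGr {n : ℕ} {x : M.carrier} (hx : M.d x ∈ shiftGr 1 M.gr n) :
    M.d (gradedProj M.gr n x) = M.d x := by
  cases n with
  | zero => simpa [mem_shiftGr, d_gradedProj_zero, eq_comm] using hx
  | succ n =>
    rw [add_comm, shiftGr_add_left] at hx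
    rw [d_gradedProj_succ, gradedProj_of_mem hx]

theorem d_gradedProj_of_d_eq_zero {x : M.carrier} (hx : M.d x = 0) (n : ℕ) :
    M.d (gradedProj M.gr n x) = 0 := by
  rw [d_gradedProj_of_d_mem_shiftGr (hx ▸ zero_mem _), hx]

end DGDMod

/-! ### Semi-free modules -/

namespace DGDAlg

variable {k : Type v} {O : Type u} [Field k] [CommRing O] [Algebra k O] (A : DGDAlg k O)

/-- A `𝒟`-module with an action of the algebra `A` such that `A ⊗_O M → M` is `𝒟`-linear, without
grading and differential. -/
class LeibnizSMul (M : Type*) [AddCommGroup M] [Module O M] [Module (DiffOp k O) M]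
    [Module A.carrier M] : Prop where
  ofDer_smul_smul : ∀ (θ : Derivation k O O) (a : A.carrier) (x : M),
    DiffOp.ofDer θ • a • x = (DiffOp.ofDer θ • a) • x + a • DiffOp.ofDer θ • x

instance (M : DGDMod A) : A.LeibnizSMul M.carrier := ⟨M.der_smul⟩

/-- The free module `A ⊗_O V`, where `V` is the free `𝒟`-module with basis `ι`. -/
abbrev Free (ι : Type*) : Type _ := FreeTensor k O A.carrier ι

/-- The generators of the free module. -/
noncomputable def freeBasis {ι : Type*} (i : ι) : A.Free ι := 1 ⊗ₜ Finsupp.single i 1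

variable {A} in
theorem smul_freeBasis {ι : Type*} (a : A.carrier) (i : ι) :
    a • A.freeBasis i = a ⊗ₜ Finsupp.single i 1 := by
  rw [freeBasis, TensorProduct.smul_tmul', smul_eq_mul, mul_one]

section LeibnizSMul

variable {M : Type*} [AddCommGroup M] [Module O M] [Module (DiffOp k O) M]
  [Module A.carrier M] [A.LeibnizSMul M] [IsScalarTower O A.carrier M]

theorem isLeibniz_lsmul :
    IsLeibniz k (Algebra.lsmul O O M : A.carrier →ₐ[O] Module.End O M).toLinearMap :=
  LeibnizSMul.ofDer_smul_smul

variable [CharZero k] [Module.Finite O Ω[O⁄k]] [Module.Projective O Ω[O⁄k]]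
  [IsScalarTower O (DiffOp k O) M] {ι : Type*}

variable {A} in
theorem smul_mem_of_mem_span {W : Submodule (DiffOp k O) A.carrier} {s : Set M}
    {T : Submodule (DiffOp k O) M} (h : ∀ a ∈ W, ∀ x ∈ s, a • x ∈ T) {a : A.carrier} (ha : a ∈ W)
    {x : M} (hx : x ∈ Submodule.span (DiffOp k O) s) : a • x ∈ T :=
  A.isLeibniz_lsmul.apply_mem_of_mem_span h hx a ha

instance : A.LeibnizSMul (A.Free ι) where
  ofDer_smul_smul θ a t := by
    induction t using TensorProduct.induction_on with
    | zero => simp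
    | tmul b w =>
      simp only [TensorProduct.smul_tmul', FreeTensor.ofDer_smul_tmul, smul_add, smul_eq_mul,
        A.der_mul, TensorProduct.add_tmul, add_assoc]
    | add s t hs ht =>
      simp only [smul_add, hs, ht]
      abel

/-- The `A`- and `𝒟`-linear map `a ⊗ ∑ P_i e_i ↦ a • ∑ P_i • m_i` on the free module. -/
noncomputable def freeLift (m : ι → M) : A.Free ι →ₗ[DiffOp k O] M :=
  FreeTensor.lift (A.isLeibniz_lsmul.compl₁₂ .id (Finsupp.linearCombination (DiffOp k O) m))

/-- The map `a ⊗ ∑ P_i e_i ↦ d a • ∑ P_i • m_i + (-1)^|a| a • ∑ P_i • δ_i` on the free module. When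
`M` has a differential with `d m_i = δ_i`, it is the composite of `d` and `A.freeLift m`. -/
noncomputable def freeDeriv (m δ : ι → M) : A.Free ι →ₗ[DiffOp k O] M :=
  FreeTensor.lift <|
    (A.isLeibniz_lsmul.compl₁₂ A.d (Finsupp.linearCombination (DiffOp k O) m)).add
      (A.isLeibniz_lsmul.compl₁₂ A.sign (Finsupp.linearCombination (DiffOp k O) δ))

variable {A}

theorem freeLift_tmul (m : ι → M) (a : A.carrier) (w : ι →₀ DiffOp k O) :
    A.freeLift m (a ⊗ₜ w) = a • Finsupp.linearCombination (DiffOp k O) m w := rfl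

@[simp]
theorem freeLift_tmul_single (m : ι → M) (a : A.carrier) (i : ι) :
    A.freeLift m (a ⊗ₜ Finsupp.single i 1) = a • m i := by
  rw [freeLift_tmul, Finsupp.linearCombination_single, one_smul]

@[simp]
theorem freeLift_freeBasis (m : ι → M) (i : ι) : A.freeLift m (A.freeBasis i) = m i := by
  rw [freeBasis, freeLift_tmul_single, one_smul]

theorem freeLift_smul (m : ι → M) (a : A.carrier) (t : A.Free ι) :
    A.freeLift m (a • t) = a • A.freeLift m t := by
  induction t using TensorProduct.induction_on with
  | zero => simp
  | tmul b w => rw [TensorProduct.smul_tmul', freeLift_tmul, smul_eq_mul, mul_smul, freeLift_tmul]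
  | add s t hs ht => rw [smul_add, map_add, hs, ht, map_add, smul_add]

theorem freeLift_freeBasis_eq_id : A.freeLift (A.freeBasis (ι := ι)) = .id :=
  FreeTensor.hom_ext fun a i => by rw [freeLift_tmul_single, smul_freeBasis, LinearMap.id_apply]

theorem freeDeriv_tmul (m δ : ι → M) (a : A.carrier) (w : ι →₀ DiffOp k O) :
    A.freeDeriv m δ (a ⊗ₜ w) = A.d a • Finsupp.linearCombination (DiffOp k O) m w +
      A.sign a • Finsupp.linearCombination (DiffOp k O) δ w := rfl

@[simp]
theorem freeDeriv_tmul_single (m δ : ι → M) (a : A.carrier) (i : ι) :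
    A.freeDeriv m δ (a ⊗ₜ Finsupp.single i 1) = A.d a • m i + A.sign a • δ i := by
  simp only [freeDeriv_tmul, Finsupp.linearCombination_single, one_smul]

theorem freeDeriv_smul (m δ : ι → M) (a : A.carrier) (t : A.Free ι) :
    A.freeDeriv m δ (a • t) = A.d a • A.freeLift m t + A.sign a • A.freeDeriv m δ t := by
  induction t using TensorProduct.induction_on with
  | zero => simp
  | tmul b w =>
    rw [TensorProduct.smul_tmul', smul_eq_mul, freeDeriv_tmul, freeDeriv_tmul, freeLift_tmul,
      d_mul', sign_mul, add_smul, smul_add, mul_smul, mul_smul, mul_smul, add_assoc]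
  | add s t hs ht =>
    simp only [smul_add, map_add, hs, ht]
    abel

theorem map_freeLift {N : Type*} [AddCommGroup N] [Module O N] [Module (DiffOp k O) N]
    [Module A.carrier N] [A.LeibnizSMul N] [IsScalarTower O A.carrier N]
    [IsScalarTower O (DiffOp k O) N] (φ : M →ₗ[DiffOp k O] N)
    (hφ : ∀ (a : A.carrier) x, φ (a • x) = a • φ x) (m : ι → M) (t : A.Free ι) :
    φ (A.freeLift m t) = A.freeLift (φ ∘ m) t := by
  suffices φ ∘ₗ A.freeLift m = A.freeLift (φ ∘ m) from LinearMap.congr_fun this t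
  exact FreeTensor.hom_ext fun a i => by simp [hφ]

theorem freeLift_freeLift_freeBasis {κ : Type*} (m : ι → M) (g : κ → ι) (t : A.Free κ) :
    A.freeLift m (A.freeLift (A.freeBasis ∘ g) t) = A.freeLift (m ∘ g) t := by
  rw [map_freeLift _ (freeLift_smul m)]
  exact congrArg (A.freeLift · t) (funext fun i => freeLift_freeBasis m (g i))

theorem map_freeLift_eq_freeDeriv (D : M →ₗ[DiffOp k O] M)
    (hD : ∀ (a : A.carrier) x, D (a • x) = A.d a • x + A.sign a • D x) (m : ι → M) (t : A.Free ι) :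
    D (A.freeLift m t) = A.freeDeriv m (D ∘ m) t := by
  suffices D ∘ₗ A.freeLift m = A.freeDeriv m (D ∘ m) from LinearMap.congr_fun this t
  exact FreeTensor.hom_ext fun a i => by simp [hD]

end LeibnizSMul

section Grading

variable {ι : Type*} [CharZero k] [Module.Finite O Ω[O⁄k]] [Module.Projective O Ω[O⁄k]]
  (deg : ι → ℕ)

/-- The grading of the free module in which the generator `e_i` has degree `deg i`. -/
noncomputable def freeGr (n : ℕ) : Submodule (DiffOp k O) (A.Free ι) :=
  Submodule.span (DiffOp k O)
    {t | ∃ a i, a ∈ shiftGr (deg i) A.gr n ∧ a ⊗ₜ Finsupp.single i 1 = t}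

variable {A deg}

theorem tmul_single_mem_freeGr {n : ℕ} {a : A.carrier} (ha : a ∈ A.gr n) (i : ι) :
    a ⊗ₜ Finsupp.single i 1 ∈ A.freeGr deg (deg i + n) :=
  Submodule.subset_span ⟨a, i, by rwa [shiftGr_add_left], rfl⟩

theorem freeBasis_mem (i : ι) : A.freeBasis i ∈ A.freeGr deg (deg i) :=
  tmul_single_mem_freeGr A.one_mem i

theorem map_mem_of_mem_freeGr {M : Type*} [AddCommGroup M] [Module (DiffOp k O) M]
    {φ : A.Free ι →ₗ[DiffOp k O] M} {T : ℕ → Submodule (DiffOp k O) M}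
    (h : ∀ n, ∀ a ∈ A.gr n, ∀ i, φ (a ⊗ₜ Finsupp.single i 1) ∈ T (deg i + n)) {n : ℕ}
    {t : A.Free ι} (ht : t ∈ A.freeGr deg n) : φ t ∈ T n := by
  suffices A.freeGr deg n ≤ (T n).comap φ from this ht
  rw [freeGr, Submodule.span_le]
  rintro _ ⟨a, i, ha, rfl⟩
  rcases mem_shiftGr.1 ha with rfl | ⟨j, rfl, haj⟩
  exacts [by simp, h j a haj i]

theorem smul_mem_freeGr {i j : ℕ} {a : A.carrier} {t : A.Free ι} (ha : a ∈ A.gr i)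
    (ht : t ∈ A.freeGr deg j) : a • t ∈ A.freeGr deg (i + j) := by
  refine smul_mem_of_mem_span ?_ ha ht
  rintro a ha _ ⟨b, l, hb, rfl⟩
  rcases mem_shiftGr.1 hb with rfl | ⟨j, rfl, hbj⟩
  · simp
  · rw [TensorProduct.smul_tmul', add_left_comm]
    exact tmul_single_mem_freeGr (A.mul_mem ha hbj) l

theorem iSup_freeGr : ⨆ n, A.freeGr deg n = ⊤ := by
  rw [eq_top_iff, ← FreeTensor.span_tmul_single_eq_top, Submodule.span_le]
  rintro _ ⟨a, i, rfl⟩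
  induction a using homogeneous_induction with
  | mem n a ha => exact Submodule.mem_iSup_of_mem _ (tmul_single_mem_freeGr ha i)
  | add a b ha hb => rw [TensorProduct.add_tmul]; exact add_mem ha hb

theorem iSupIndep_freeGr : iSupIndep (A.freeGr deg) := by
  refine iSupIndep_of_forall_map_le (J := ι × O)
    (fun j => iSupIndep_shiftGr A.isInternal.submodule_iSupIndep (deg j.1))
    (fun j => FreeTensor.coord j.1 j.2)
    (fun t h => FreeTensor.eq_zero_of_coord_eq_zero fun i f => h (i, f)) ?_
  rintro ⟨i, f⟩ n _ ⟨t, ht, rfl⟩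
  refine map_mem_of_mem_freeGr (fun n a ha l => ?_) ht
  rcases eq_or_ne l i with rfl | hli
  · simpa [← DiffOp.ofFun_smul (k := k)] using (A.gr n).smul_mem (DiffOp.ofFun k f) ha
  · simp [Finsupp.single_eq_of_ne' hli]

theorem isInternal_freeGr : DirectSum.IsInternal (A.freeGr deg) :=
  DirectSum.isInternal_submodule_of_iSupIndep_of_iSup_eq_top iSupIndep_freeGr iSup_freeGr

theorem freeLift_mem {M : DGDMod A} {m : ι → M.carrier} (hm : ∀ i, m i ∈ M.gr (deg i)) {n : ℕ}
    {t : A.Free ι} (ht : t ∈ A.freeGr deg n) : A.freeLift m t ∈ M.gr n := by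
  refine map_mem_of_mem_freeGr (fun n a ha i => ?_) ht
  rw [freeLift_tmul_single, add_comm]
  exact M.smul_mem ha (hm i)

end Grading

section Differential

variable {ι : Type*} [CharZero k] [Module.Finite O Ω[O⁄k]] [Module.Projective O Ω[O⁄k]]

/-- The differential of the free module for which the generators have boundaries `δ i`. -/
noncomputable def freeDiff (δ : ι → A.Free ι) : A.Free ι →ₗ[DiffOp k O] A.Free ι :=
  A.freeDeriv A.freeBasis δ

variable {A} {δ : ι → A.Free ι}

theorem freeDiff_tmul_single (a : A.carrier) (i : ι) :
    A.freeDiff δ (a ⊗ₜ Finsupp.single i 1) =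
      A.d a ⊗ₜ Finsupp.single i 1 + A.sign a • δ i := by
  rw [freeDiff, freeDeriv_tmul_single, smul_freeBasis]

theorem freeDiff_freeBasis (i : ι) : A.freeDiff δ (A.freeBasis i) = δ i := by
  rw [freeBasis, freeDiff_tmul_single, d_one, sign_one, TensorProduct.zero_tmul, zero_add, one_smul]

theorem freeDiff_smul (a : A.carrier) (t : A.Free ι) :
    A.freeDiff δ (a • t) = A.d a • t + A.sign a • A.freeDiff δ t := by
  rw [freeDiff, freeDeriv_smul, freeLift_freeBasis_eq_id, LinearMap.id_apply]

/-- The condition for elements `δ i` of the free module to be the boundaries of its generators. -/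
structure IsAttaching (deg : ι → ℕ) (δ : ι → A.Free ι) : Prop where
  mem : ∀ i, δ i ∈ shiftGr 1 (A.freeGr deg) (deg i)
  cycle : ∀ i, A.freeDiff δ (δ i) = 0

variable {deg : ι → ℕ}

theorem freeDiff_mem (h : ∀ i, δ i ∈ shiftGr 1 (A.freeGr deg) (deg i)) {n : ℕ} {t : A.Free ι}
    (ht : t ∈ A.freeGr deg n) : A.freeDiff δ t ∈ shiftGr 1 (A.freeGr deg) n := by
  refine map_mem_of_mem_freeGr (fun n a ha i => ?_) ht
  rw [freeDiff_tmul_single]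
  refine add_mem ?_ ?_
  · exact map_mem_shiftGr (f := (TensorProduct.mk O A.carrier _).flip (Finsupp.single i 1))
      (fun m b hb => tmul_single_mem_freeGr hb i) (A.d_mem_shiftGr ha)
  · rw [add_comm]
    exact map_mem_shiftGr (f := Algebra.lsmul O O (A.Free ι) (A.sign a))
      (fun m t ht => smul_mem_freeGr (sign_mem ha) ht) (h i)

theorem IsAttaching.freeDiff_freeDiff (h : IsAttaching deg δ) (t : A.Free ι) :
    A.freeDiff δ (A.freeDiff δ t) = 0 := by
  suffices A.freeDiff δ ∘ₗ A.freeDiff δ = 0 from LinearMap.congr_fun this t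
  refine FreeTensor.hom_ext fun a i => ?_
  rw [LinearMap.comp_apply, freeDiff_tmul_single, map_add, freeDiff_tmul_single, freeDiff_smul,
    h.cycle, A.d_d, d_sign, TensorProduct.zero_tmul, zero_add, smul_zero, add_zero, ← add_smul,
    add_neg_cancel, zero_smul, LinearMap.zero_apply]

end Differential

section FreeDGDMod

variable {A} {ι : Type u} [CharZero k] [Module.Finite O Ω[O⁄k]] [Module.Projective O Ω[O⁄k]]
  {deg : ι → ℕ} {δ : ι → A.Free ι}

/-- The semi-free `A`-module `(A ⊗_O V, d)` with `d e_i = δ i`. -/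
noncomputable def semiFree (h : IsAttaching deg δ) : DGDMod A where
  carrier := A.Free ι
  gr := A.freeGr deg
  isInternal := isInternal_freeGr
  smul_mem := smul_mem_freeGr
  der_smul := LeibnizSMul.ofDer_smul_smul
  d := A.freeDiff δ
  d_mem ht := by simpa only [shiftGr_one_succ] using freeDiff_mem h.mem ht
  d_of_mem_zero ht := by
    simpa only [shiftGr_one_zero, Submodule.mem_bot] using freeDiff_mem h.mem ht
  d_d := h.freeDiff_freeDiff
  d_smul t ha := (freeDiff_smul _ t).trans (congrArg _ (sign_smul_of_mem (M := A.Free ι) ha _))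

end FreeDGDMod

end DGDAlg

/-! ### Trivial fibrations -/

namespace DGDMod

variable {k : Type v} {O : Type u} [Field k] [CommRing O] [Algebra k O] {A : DGDAlg k O}
  {M N : DGDMod A} {f : M ⟶ N}

theorem mapHomology_injective_iff : Function.Injective (mapHomology f) ↔
    ∀ x, M.d x = 0 → f.toLin x ∈ LinearMap.range N.d → x ∈ LinearMap.range M.d := by
  rw [injective_iff_map_eq_zero]
  constructor
  · intro h x hx hfx
    exact (Submodule.Quotient.mk_eq_zero M.boundaries).1
      (h (Submodule.Quotient.mk ⟨x, hx⟩) ((Submodule.Quotient.mk_eq_zero _).2 hfx))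
  · intro h x
    obtain ⟨⟨x, hx⟩, rfl⟩ := Submodule.Quotient.mk_surjective _ x
    intro hfx
    exact (Submodule.Quotient.mk_eq_zero _).2
      (h x hx ((Submodule.Quotient.mk_eq_zero N.boundaries).1 hfx))

theorem mapHomology_surjective_iff : Function.Surjective (mapHomology f) ↔
    ∀ y, N.d y = 0 → ∃ x, M.d x = 0 ∧ f.toLin x - y ∈ LinearMap.range N.d := by
  constructor
  · intro h y hy
    obtain ⟨x, hx⟩ := h (Submodule.Quotient.mk ⟨y, hy⟩)
    obtain ⟨⟨x, hx'⟩, rfl⟩ := Submodule.Quotient.mk_surjective _ x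
    exact ⟨x, hx', (Submodule.Quotient.eq N.boundaries).1 hx⟩
  · intro h y
    obtain ⟨⟨y, hy⟩, rfl⟩ := Submodule.Quotient.mk_surjective _ y
    obtain ⟨x, hx, hxy⟩ := h y hy
    exact ⟨Submodule.Quotient.mk ⟨x, hx⟩, (Submodule.Quotient.eq _).2 hxy⟩

theorem exists_cycle_of_trivialFibrations (hf : trivialFibrations (DGDMod A) f) {n : ℕ}
    {y : N.carrier} (hy : y ∈ N.gr n) (hdy : N.d y = 0) :
    ∃ x ∈ M.gr n, f.toLin x = y ∧ M.d x = 0 := by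
  obtain ⟨z, hz, w, hw⟩ := mapHomology_surjective_iff.1 hf.2.2 y hdy
  obtain ⟨t, ht, hft⟩ := hf.1 (n + 1) n.succ_pos (gradedProj N.gr (n + 1) w) (gradedProj_mem _ _)
  refine ⟨gradedProj M.gr n z - M.d t, sub_mem (gradedProj_mem _ _) (M.d_mem ht), ?_, ?_⟩
  · rw [map_sub, f.map_d, hft, d_gradedProj_succ, hw, map_gradedProj, map_sub,
      gradedProj_of_mem hy, sub_sub_cancel]
  · rw [map_sub, d_gradedProj_of_d_eq_zero hz, M.d_d, sub_zero]

theorem exists_mem_of_trivialFibrations (hf : trivialFibrations (DGDMod A) f) {n : ℕ}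
    {y : N.carrier} (hy : y ∈ N.gr n) : ∃ x ∈ M.gr n, f.toLin x = y := by
  rcases Nat.eq_zero_or_pos n with rfl | hn
  · obtain ⟨x, hx, hfx, -⟩ := exists_cycle_of_trivialFibrations hf hy (N.d_of_mem_zero hy)
    exact ⟨x, hx, hfx⟩
  · exact hf.1 n hn y hy

variable (f) in
/-- The lifting property of `f` with respect to the inclusions of spheres into disks: the pair of
`w` and `y` is a square from the inclusion of the `(n - 1)`-sphere into the `n`-disk to `f`, where
`w = 0` when `n = 0`. -/
def LiftsDisks : Prop :=
  ∀ n, ∀ y ∈ N.gr n, ∀ w ∈ shiftGr 1 M.gr n, M.d w = 0 → f.toLin w = N.d y →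
    ∃ x ∈ M.gr n, f.toLin x = y ∧ M.d x = w

theorem liftsDisks_of_trivialFibrations (hf : trivialFibrations (DGDMod A) f) :
    LiftsDisks f := by
  intro n y hy w hw hdw hfw
  obtain ⟨x, hx, hfx⟩ := exists_mem_of_trivialFibrations hf hy
  have hf0 : f.toLin (w - M.d x) = 0 := by rw [map_sub, f.map_d, hfx, hfw, sub_self]
  obtain ⟨t, ht⟩ := mapHomology_injective_iff.1 hf.2.1 (w - M.d x)
    (by rw [map_sub, hdw, M.d_d, sub_zero]) (hf0 ▸ zero_mem _)
  have ht' : M.d (gradedProj M.gr n t) = w - M.d x := by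
    rw [d_gradedProj_of_d_mem_shiftGr (ht ▸ sub_mem hw (M.d_mem_shiftGr hx)), ht]
  obtain ⟨z, hz, hfz, hdz⟩ := exists_cycle_of_trivialFibrations hf
    (f.map_mem (gradedProj_mem (gr := M.gr) n t)) (by rw [← f.map_d, ht', hf0])
  refine ⟨x + (gradedProj M.gr n t - z), add_mem hx (sub_mem (gradedProj_mem _ _) hz), ?_, ?_⟩
  · rw [map_add, map_sub, hfz, hfx, sub_self, add_zero]
  · rw [map_add, map_sub, ht', hdz, sub_zero, add_sub_cancel]

theorem LiftsDisks.exists_cycle (hf : LiftsDisks f) {n : ℕ} {y : N.carrier} (hy : y ∈ N.gr n)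
    (hdy : N.d y = 0) : ∃ x ∈ M.gr n, f.toLin x = y ∧ M.d x = 0 :=
  hf n y hy 0 (zero_mem _) (map_zero _) (by rw [map_zero, hdy])

theorem LiftsDisks.fibrations (hf : LiftsDisks f) : fibrations (DGDMod A) f := by
  intro n hn y hy
  obtain ⟨m, rfl⟩ := Nat.exists_eq_add_one.2 hn
  obtain ⟨w, hw, hfw, hdw⟩ := hf.exists_cycle (N.d_mem hy) (N.d_d y)
  obtain ⟨x, hx, hfx, -⟩ := hf (m + 1) y hy w (by rwa [shiftGr_one_succ]) hdw hfw
  exact ⟨x, hx, hfx⟩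

theorem LiftsDisks.mapHomology_injective (hf : LiftsDisks f) :
    Function.Injective (mapHomology f) := by
  rw [mapHomology_injective_iff]
  rintro w hw ⟨y, hy⟩
  refine mem_of_gradedProj_mem (gr := M.gr) fun n => ?_
  obtain ⟨x, -, -, hx⟩ := hf (n + 1) (gradedProj N.gr (n + 1) y) (gradedProj_mem _ _)
    (gradedProj M.gr n w) (by rw [shiftGr_one_succ]; exact gradedProj_mem _ _)
    (d_gradedProj_of_d_eq_zero hw n) (by rw [map_gradedProj, d_gradedProj_succ, hy])
  exact ⟨x, hx⟩

theorem LiftsDisks.mapHomology_surjective (hf : LiftsDisks f) :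
    Function.Surjective (mapHomology f) := by
  rw [mapHomology_surjective_iff]
  intro y hy
  have hy' : y ∈ M.cycles.map f.toLin := by
    refine mem_of_gradedProj_mem (gr := N.gr) fun n => ?_
    obtain ⟨x, -, hfx, hx⟩ :=
      hf.exists_cycle (gradedProj_mem n y) (d_gradedProj_of_d_eq_zero hy n)
    exact ⟨x, hx, hfx⟩
  obtain ⟨x, hx, rfl⟩ := hy'
  exact ⟨x, hx, sub_self (f.toLin x) ▸ zero_mem _⟩

theorem trivialFibrations_iff_liftsDisks : trivialFibrations (DGDMod A) f ↔ LiftsDisks f :=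
  ⟨liftsDisks_of_trivialFibrations, fun h =>
    ⟨h.fibrations, h.mapHomology_injective, h.mapHomology_surjective⟩⟩

end DGDMod

theorem llp_initial_to_iff {C : Type*} [Category C] [HasInitial C] {W : MorphismProperty C}
    {X : C} : W.llp (initial.to X) ↔
      ∀ ⦃Y Z : C⦄ (p : Y ⟶ Z), W p → ∀ g : X ⟶ Z, ∃ l : X ⟶ Y, l ≫ p = g := by
  constructor
  · intro h Y Z p hp g
    have := h p hp
    have sq : CommSq (initial.to Y) (initial.to X) p g := ⟨initial.hom_ext _ _⟩
    exact ⟨sq.lift, sq.fac_right⟩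
  · intro h Y Z p hp
    refine ⟨fun {f g} sq => ?_⟩
    obtain ⟨l, hl⟩ := h p hp g
    exact ⟨⟨⟨l, initial.hom_ext _ _, hl⟩⟩⟩

theorem DGDMod.isCofibrant_iff_exists_lift {k : Type v} {O : Type u} [Field k] [CommRing O]
    [Algebra k O] {A : DGDAlg k O} {C : DGDMod A} : IsCofibrant C ↔
      ∀ ⦃X Y : DGDMod A⦄ (p : X ⟶ Y), LiftsDisks p → ∀ g : C ⟶ Y, ∃ l : C ⟶ X, l ≫ p = g := by
  simp only [← trivialFibrations_iff_liftsDisks, ← llp_initial_to_iff, cofibration_iff]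
  rfl

/-! ### Lifting from Sullivan modules -/

theorem exists_forall_of_wellFoundedLT {ι : Type*} [LT ι] [WellFoundedLT ι] {X : ι → Type*}
    [∀ i, Nonempty (X i)] (P : ∀ i, (∀ j, X j) → X i → Prop)
    (congr : ∀ i x x' y, (∀ j < i, x j = x' j) → P i x y → P i x' y)
    (step : ∀ i x, (∀ j < i, P j x (x j)) → ∃ y, P i x y) : ∃ x, ∀ i, P i x (x i) := by
  classical
  let extend (i : ι) (x : ∀ j, j < i → X j) (j : ι) : X j :=
    if h : j < i then x j h else Classical.arbitrary _
  let choice (i : ι) (x : ∀ j, j < i → X j) : X i := Classical.epsilon (P i (extend i x))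
  let x : ∀ i, X i := (wellFounded_lt (α := ι)).fix choice
  have hx (i : ι) : x i = choice i fun j _ => x j := (wellFounded_lt (α := ι)).fix_eq choice i
  have hext (i : ι) : ∀ j < i, extend i (fun j _ => x j) j = x j := fun j hj => dif_pos hj
  refine ⟨x, fun i => ?_⟩
  induction i using WellFoundedLT.induction with
  | ind i ih =>
    obtain ⟨y, hy⟩ := step i x ih
    refine congr i _ x _ (hext i) ?_
    rw [hx]
    exact Classical.epsilon_spec ⟨y, congr i x _ y (fun j hj => (hext i j hj).symm) hy⟩

namespace DGDMod

variable {k : Type v} {O : Type u} [Field k] [CommRing O] [Algebra k O] [CharZero k]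
  [Module.Finite O Ω[O⁄k]] [Module.Projective O Ω[O⁄k]] {A : DGDAlg k O} {S X Y : DGDMod A}
  {ι : Type*}

theorem d_map_freeLift (Φ : S.carrier →ₗ[DiffOp k O] X.carrier)
    (hΦ : ∀ (a : A.carrier) s, Φ (a • s) = a • Φ s) {m : ι → S.carrier}
    (h : ∀ i, X.d (Φ (m i)) = Φ (S.d (m i))) (t : A.Free ι) :
    X.d (Φ (A.freeLift m t)) = Φ (S.d (A.freeLift m t)) := by
  suffices X.d ∘ₗ Φ ∘ₗ A.freeLift m = Φ ∘ₗ S.d ∘ₗ A.freeLift m from LinearMap.congr_fun this t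
  exact FreeTensor.hom_ext fun a i => by simp [hΦ, d_smul', h]

/-- `m` identifies the graded `A`-module underlying `S` with `A ⊗_O V`, where `V` is the free
graded `𝒟`-module with generators of degrees `deg i`. -/
structure IsGradedBasis (deg : ι → ℕ) (m : ι → S.carrier) : Prop where
  mem : ∀ i, m i ∈ S.gr (deg i)
  bijective : Function.Bijective (A.freeLift m)

namespace IsGradedBasis

variable {deg : ι → ℕ} {m : ι → S.carrier}

theorem exists_freeLift_eq (b : IsGradedBasis deg m) {n : ℕ} {s : S.carrier} (hs : s ∈ S.gr n) :
    ∃ t ∈ A.freeGr deg n, A.freeLift m t = s := by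
  obtain ⟨t, rfl⟩ := b.bijective.2 s
  let _ := (DGDAlg.isInternal_freeGr (A := A) (deg := deg)).chooseDecomposition
  exact ⟨t, mem_of_map_mem (gr := A.freeGr deg) (gr' := S.gr)
    (fun _ _ => DGDAlg.freeLift_mem b.mem) b.bijective.1 hs, rfl⟩

theorem hom_ext (b : IsGradedBasis deg m) {f g : S ⟶ X}
    (h : ∀ i, f.toLin (m i) = g.toLin (m i)) : f = g := by
  refine Hom.ext (LinearMap.ext fun s => ?_)
  obtain ⟨t, rfl⟩ := b.bijective.2 s
  rw [DGDAlg.map_freeLift _ f.map_smul, DGDAlg.map_freeLift _ g.map_smul,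
    show f.toLin ∘ m = g.toLin ∘ m from funext h]

/-- The `A`- and `𝒟`-linear map with prescribed values on a basis. -/
noncomputable def constr (b : IsGradedBasis deg m) (x : ι → X.carrier) :
    S.carrier →ₗ[DiffOp k O] X.carrier :=
  A.freeLift x ∘ₗ (LinearEquiv.ofBijective (A.freeLift m) b.bijective).symm.toLinearMap

variable (b : IsGradedBasis deg m) (x : ι → X.carrier)

theorem constr_freeLift (t : A.Free ι) : b.constr x (A.freeLift m t) = A.freeLift x t :=
  congrArg (A.freeLift x) (LinearEquiv.ofBijective_symm_apply_apply _ t)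

theorem constr_apply (i : ι) : b.constr x (m i) = x i := by
  rw [← DGDAlg.freeLift_freeBasis (A := A) m, constr_freeLift, DGDAlg.freeLift_freeBasis]

theorem constr_smul (a : A.carrier) (s : S.carrier) : b.constr x (a • s) = a • b.constr x s := by
  obtain ⟨t, rfl⟩ := b.bijective.2 s
  rw [← DGDAlg.freeLift_smul, constr_freeLift, constr_freeLift, DGDAlg.freeLift_smul]

theorem constr_freeLift_comp {κ : Type*} (φ : κ → ι) (t : A.Free κ) :
    b.constr x (A.freeLift (m ∘ φ) t) = A.freeLift (x ∘ φ) t := by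
  rw [DGDAlg.map_freeLift _ (b.constr_smul x)]
  exact congrArg (A.freeLift · t) (funext fun j => b.constr_apply x (φ j))

variable {x}

theorem constr_mem (hx : ∀ i, x i ∈ X.gr (deg i)) {n : ℕ} {s : S.carrier} (hs : s ∈ S.gr n) :
    b.constr x s ∈ X.gr n := by
  obtain ⟨t, ht, rfl⟩ := b.exists_freeLift_eq hs
  exact b.constr_freeLift x t ▸ DGDAlg.freeLift_mem hx ht

/-- The morphism with prescribed values on a basis. -/
noncomputable def hom (hx : ∀ i, x i ∈ X.gr (deg i))
    (hd : ∀ i, X.d (x i) = b.constr x (S.d (m i))) : S ⟶ X where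
  toLin := b.constr x
  map_smul := b.constr_smul x
  map_mem := b.constr_mem hx
  map_d s := by
    obtain ⟨t, rfl⟩ := b.bijective.2 s
    exact (d_map_freeLift _ (b.constr_smul x) (fun i => by rw [constr_apply, hd]) t).symm

end IsGradedBasis

variable {deg : ι → ℕ} {m : ι → S.carrier}

theorem LiftsDisks.exists_lift_basis [LT ι] {p : X ⟶ Y} (hp : LiftsDisks p) (g : S ⟶ Y)
    (b : IsGradedBasis deg m) {i : ι}
    (hi : S.d (m i) ∈ LinearMap.range (A.freeLift fun j : {j // j < i} => m j))
    {x : ι → X.carrier} (hx : ∀ j, x j ∈ X.gr (deg j))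
    (hpx : ∀ j < i, p.toLin (x j) = g.toLin (m j))
    (hdx : ∀ j < i, X.d (x j) = b.constr x (S.d (m j))) :
    ∃ y ∈ X.gr (deg i), p.toLin y = g.toLin (m i) ∧ X.d y = b.constr x (S.d (m i)) := by
  obtain ⟨t, ht⟩ := hi
  refine hp _ _ (g.map_mem (b.mem i)) _ ?_ ?_ ?_
  · simpa only [zero_add] using map_mem_shiftGr (i := 0) (f := b.constr x)
      (fun n s hs => (zero_add n).symm ▸ b.constr_mem hx hs) (S.d_mem_shiftGr (b.mem i))
  · rw [← ht, d_map_freeLift _ (b.constr_smul x) (fun j => by rw [b.constr_apply, hdx j j.2]), ht,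
      S.d_d, map_zero]
  · rw [← g.map_d, ← ht]
    refine (congrArg p.toLin (b.constr_freeLift_comp x Subtype.val t)).trans ?_
    rw [DGDAlg.map_freeLift _ p.map_smul, DGDAlg.map_freeLift _ g.map_smul]
    exact congrArg (A.freeLift · t) (funext fun j => hpx j j.2)

theorem IsSullivan.exists_lift (hS : S.IsSullivan) {p : X ⟶ Y} (hp : LiftsDisks p) (g : S ⟶ Y) :
    ∃ l : S ⟶ X, l ≫ p = g := by
  obtain ⟨ι, _, _, deg, m, hm, hbij, hd⟩ := hS
  let b : IsGradedBasis deg m := ⟨hm, hbij⟩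
  obtain ⟨x, hx⟩ : ∃ x : ∀ i, X.gr (deg i), ∀ i, p.toLin (x i) = g.toLin (m i) ∧
      X.d (x i) = b.constr (fun j => (x j : X.carrier)) (S.d (m i)) := by
    refine exists_forall_of_wellFoundedLT (fun i x (y : X.gr (deg i)) =>
      p.toLin y = g.toLin (m i) ∧ X.d y = b.constr (fun j => (x j : X.carrier)) (S.d (m i))) ?_ ?_
    · rintro i x x' y hxx' ⟨hpy, hdy⟩
      refine ⟨hpy, hdy.trans ?_⟩
      obtain ⟨t, ht⟩ := hd i
      rw [← ht]
      refine (b.constr_freeLift_comp _ Subtype.val t).trans (.trans ?_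
        (b.constr_freeLift_comp _ Subtype.val t).symm)
      exact congrArg (A.freeLift · t) (funext fun j => congrArg Subtype.val (hxx' j j.2))
    · intro i x hx
      obtain ⟨y, hy, hpy⟩ := hp.exists_lift_basis g b (hd i) (fun j => (x j).2)
        (fun j hj => (hx j hj).1) (fun j hj => (hx j hj).2)
      exact ⟨⟨y, hy⟩, hpy⟩
  refine ⟨b.hom (fun i => (x i).2) fun i => (hx i).2, b.hom_ext fun i => ?_⟩
  exact (congrArg p.toLin (b.constr_apply _ i)).trans (hx i).1

end DGDMod

/-! ### The Sullivan resolution -/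

section Resolution

variable {k : Type v} {O : Type u} [Field k] [CommRing O] [Algebra k O] {A : DGDAlg k O}

theorem DGDAlg.exists_freeLift_freeBasis_comp [CharZero k] [Module.Finite O Ω[O⁄k]]
    [Module.Projective O Ω[O⁄k]] {ι : Type*} (t : A.Free ι) :
    ∃ n, ∃ (g : Fin n → ι) (s : A.Free (Fin n)), A.freeLift (A.freeBasis ∘ g) s = t := by
  obtain ⟨n, P, y, rfl⟩ := Submodule.mem_span_set'.1
    (FreeTensor.span_tmul_single_eq_top (k := k) (O := O) (M := A.carrier) (ι := ι) ▸
      Submodule.mem_top (x := t))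
  choose a g hy using fun i => (y i).2
  refine ⟨n, g, ∑ i, P i • a i ⊗ₜ Finsupp.single i 1, ?_⟩
  rw [map_sum]
  refine Finset.sum_congr rfl fun i _ => ?_
  rw [map_smul, freeLift_tmul_single, Function.comp_apply, smul_freeBasis, hy]

/-- The formal cells over `C`. The cell `mk N n t faces c` stands for a generator of degree `N` over
`c` which is attached along the element `t` of the free module on its finitely many faces. -/
inductive Cell (C : DGDMod A) : Type u
  | mk (N n : ℕ) (t : A.Free (Fin n)) (faces : Fin n → Cell C) (c : C.carrier) : Cell C

namespace Cell

variable {C : DGDMod A}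

/-- The degree of the generator given by a cell. -/
def deg : Cell C → ℕ
  | mk N _ _ _ _ => N

/-- The face relation between cells. -/
inductive IsFace : Cell C → Cell C → Prop
  | mk (N n : ℕ) (t : A.Free (Fin n)) (faces : Fin n → Cell C) (c : C.carrier) (i : Fin n) :
      IsFace (faces i) (mk N n t faces c)

instance : IsWellFounded (Cell C) IsFace where
  wf := ⟨fun g => by
    induction g with
    | mk N n t faces c ih =>
      constructor
      rintro _ ⟨⟩
      exact ih _⟩

variable [CharZero k] [Module.Finite O Ω[O⁄k]] [Module.Projective O Ω[O⁄k]]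

/-- The condition for a formal cell to be attached along its formal boundary, in terms of the
boundaries `δ` of its faces and of their images `v` in `C`. -/
structure IsAdmissible (N : ℕ) {n : ℕ} (t : A.Free (Fin n)) (faces : Fin n → Cell C)
    (c : C.carrier) (δ : Fin n → A.Free (Cell C)) (v : Fin n → C.carrier) : Prop where
  mem : c ∈ C.gr N
  boundary_mem : A.freeLift (A.freeBasis ∘ faces) t ∈ shiftGr 1 (A.freeGr deg) N
  cycle : A.freeDeriv (A.freeBasis ∘ faces) δ t = 0
  d_eq : A.freeLift v t = C.d c

open Classical in
/-- The boundary of a cell and its image in `C`. Cells that are not admissible have boundary `0` and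
image `0`. -/
noncomputable def attach : Cell C → A.Free (Cell C) × C.carrier
  | mk N _ t faces c =>
    if IsAdmissible N t faces c (fun i => (attach (faces i)).1) (fun i => (attach (faces i)).2) then
      (A.freeLift (A.freeBasis ∘ faces) t, c) else 0

/-- The boundary of a cell. -/
noncomputable def boundary (g : Cell C) : A.Free (Cell C) := g.attach.1

/-- The image of a cell in `C`. -/
noncomputable def image (g : Cell C) : C.carrier := g.attach.2

section

variable {N n : ℕ} {t : A.Free (Fin n)} {faces : Fin n → Cell C} {c : C.carrier}

theorem IsAdmissible.attach_mk
    (h : IsAdmissible N t faces c (boundary ∘ faces) (image ∘ faces)) :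
    (Cell.mk N n t faces c).attach = (A.freeLift (A.freeBasis ∘ faces) t, c) := by
  rw [attach]
  exact if_pos h

end

theorem attach_induction {P : Cell C → A.Free (Cell C) → C.carrier → Prop}
    (admissible : ∀ N n t (faces : Fin n → Cell C) c,
      IsAdmissible N t faces c (boundary ∘ faces) (image ∘ faces) →
      P (mk N n t faces c) (A.freeLift (A.freeBasis ∘ faces) t) c)
    (zero : ∀ g, P g 0 0) (g : Cell C) : P g g.boundary g.image := by
  obtain ⟨N, n, t, faces, c⟩ := g
  rw [boundary, image]
  by_cases h : IsAdmissible N t faces c (boundary ∘ faces) (image ∘ faces)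
  · rw [h.attach_mk]
    exact admissible N n t faces c h
  · rw [show (mk N n t faces c).attach = 0 by rw [attach]; exact if_neg h]
    exact zero _

theorem freeDiff_boundary_comp {n : ℕ} (faces : Fin n → Cell C) (t : A.Free (Fin n)) :
    A.freeDiff boundary (A.freeLift (A.freeBasis ∘ faces) t) =
      A.freeDeriv (A.freeBasis ∘ faces) (boundary ∘ faces) t := by
  rw [DGDAlg.map_freeLift_eq_freeDeriv _ DGDAlg.freeDiff_smul]
  exact congrArg (A.freeDeriv _ · t) (funext fun i => DGDAlg.freeDiff_freeBasis (faces i))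

theorem isAttaching_boundary : DGDAlg.IsAttaching deg (boundary (C := C)) where
  mem := attach_induction (P := fun g b _ => b ∈ shiftGr 1 (A.freeGr deg) g.deg)
    (fun _ _ _ _ _ h => h.boundary_mem) fun _ => zero_mem _
  cycle := attach_induction (P := fun _ b _ => A.freeDiff boundary b = 0)
    (fun _ _ _ faces _ h => (freeDiff_boundary_comp faces _).trans h.cycle) fun _ => map_zero _

theorem image_mem : ∀ g : Cell C, g.image ∈ C.gr g.deg :=
  attach_induction (P := fun g _ c => c ∈ C.gr g.deg) (fun _ _ _ _ _ h => h.mem)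
    fun _ => zero_mem _

theorem freeLift_boundary : ∀ g : Cell C, A.freeLift image g.boundary = C.d g.image :=
  attach_induction (P := fun _ b c => A.freeLift image b = C.d c)
    (fun _ _ _ faces _ h => (DGDAlg.freeLift_freeLift_freeBasis image faces _).trans h.d_eq)
    fun _ => (map_zero _).trans (map_zero _).symm

theorem exists_freeLift_faces_eq_boundary (g : Cell C) :
    ∃ t, A.freeLift (fun f : {f // IsFace f g} => A.freeBasis f.1) t = g.boundary := by
  refine attach_induction (P := fun g b _ =>
    ∃ t, A.freeLift (fun f : {f // IsFace f g} => A.freeBasis f.1) t = b) ?_ ?_ g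
  · intro N n t faces c _
    let face (i : Fin n) : {f // IsFace f (mk N n t faces c)} := ⟨faces i, .mk N n t faces c i⟩
    exact ⟨A.freeLift (A.freeBasis ∘ face) t, DGDAlg.freeLift_freeLift_freeBasis _ _ _⟩
  · exact fun _ => ⟨0, map_zero _⟩

theorem exists_cell {N : ℕ} {t : A.Free (Cell C)} {c : C.carrier} (hc : c ∈ C.gr N)
    (ht : t ∈ shiftGr 1 (A.freeGr deg) N) (hcycle : A.freeDiff boundary t = 0)
    (hd : A.freeLift image t = C.d c) : ∃ g : Cell C, g.deg = N ∧ g.boundary = t ∧ g.image = c := by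
  obtain ⟨n, faces, t, rfl⟩ := DGDAlg.exists_freeLift_freeBasis_comp t
  have h : IsAdmissible N t faces c (boundary ∘ faces) (image ∘ faces) :=
    ⟨hc, ht, (freeDiff_boundary_comp faces t).symm.trans hcycle,
      (DGDAlg.freeLift_freeLift_freeBasis image faces t).symm.trans hd⟩
  exact ⟨mk N n t faces c, rfl, congrArg Prod.fst h.attach_mk, congrArg Prod.snd h.attach_mk⟩

end Cell

namespace DGDAlg

variable [CharZero k] [Module.Finite O Ω[O⁄k]] [Module.Projective O Ω[O⁄k]] {ι : Type u}
  {deg : ι → ℕ} {δ : ι → A.Free ι}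

theorem isGradedBasis_semiFree (h : IsAttaching deg δ) :
    DGDMod.IsGradedBasis (S := semiFree h) deg A.freeBasis where
  mem := freeBasis_mem
  bijective := by
    suffices Function.Bijective (A.freeLift (A.freeBasis (ι := ι))) from this
    rw [freeLift_freeBasis_eq_id]
    exact Function.bijective_id

theorem constr_isGradedBasis_semiFree (h : IsAttaching deg δ) {M : DGDMod A} (x : ι → M.carrier)
    (t : A.Free ι) : (isGradedBasis_semiFree h).constr x t = A.freeLift x t := by
  refine Eq.trans ?_ ((isGradedBasis_semiFree h).constr_freeLift x t)
  exact congrArg _ (LinearMap.congr_fun freeLift_freeBasis_eq_id t).symm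

theorem isSullivan_semiFree (h : IsAttaching deg δ) (r : ι → ι → Prop) [IsWellFounded ι r]
    (hδ : ∀ i, ∃ t, A.freeLift (fun j : {j // r j i} => A.freeBasis j.1) t = δ i) :
    (semiFree h).IsSullivan := by
  let _ := IsWellFounded.wellOrderExtension r
  refine ⟨ι, inferInstance, IsWellFounded.wellOrderExtension.isWellFounded_lt r, deg, A.freeBasis,
    freeBasis_mem, (isGradedBasis_semiFree h).bijective, fun i => ?_⟩
  obtain ⟨t, ht⟩ := hδ i
  have hlt {j : ι} (hj : r j i) : j < i := Prod.Lex.left _ _ (IsWellFounded.rank_lt_of_rel hj)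
  let below (j : {j // r j i}) : {j // j < i} := ⟨j, hlt j.2⟩
  exact ⟨A.freeLift (A.freeBasis ∘ below) t,
    (freeLift_freeLift_freeBasis _ _ _).trans (ht.trans (freeDiff_freeBasis i).symm)⟩

end DGDAlg

namespace DGDMod

variable [CharZero k] [Module.Finite O Ω[O⁄k]] [Module.Projective O Ω[O⁄k]] (C : DGDMod A)

/-- The semi-free `A`-module on the cells over `C`. -/
noncomputable def sullivanResolution : DGDMod A :=
  DGDAlg.semiFree (Cell.isAttaching_boundary (C := C))

theorem d_sullivanResolution_freeBasis (g : Cell C) :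
    C.sullivanResolution.d (A.freeBasis g) = g.boundary := DGDAlg.freeDiff_freeBasis g

theorem isGradedBasis_sullivanResolution :
    IsGradedBasis (S := C.sullivanResolution) Cell.deg A.freeBasis :=
  DGDAlg.isGradedBasis_semiFree Cell.isAttaching_boundary

/-- The map from the resolution to `C` that sends each cell to its image. -/
noncomputable def augmentation : C.sullivanResolution ⟶ C :=
  C.isGradedBasis_sullivanResolution.hom Cell.image_mem fun g => by
    rw [d_sullivanResolution_freeBasis, ← g.freeLift_boundary]
    exact (DGDAlg.constr_isGradedBasis_semiFree _ _ _).symm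

theorem augmentation_freeBasis (g : Cell C) : C.augmentation.toLin (A.freeBasis g) = g.image :=
  C.isGradedBasis_sullivanResolution.constr_apply Cell.image g

theorem liftsDisks_augmentation : LiftsDisks C.augmentation := by
  intro N c hc t ht hdt hd
  obtain ⟨g, rfl, rfl, rfl⟩ := Cell.exists_cell hc ht hdt
    ((DGDAlg.constr_isGradedBasis_semiFree _ _ _).symm.trans hd)
  exact ⟨A.freeBasis g, DGDAlg.freeBasis_mem g, C.augmentation_freeBasis g,
    C.d_sullivanResolution_freeBasis g⟩

theorem isSullivan_sullivanResolution : C.sullivanResolution.IsSullivan :=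
  DGDAlg.isSullivan_semiFree _ Cell.IsFace Cell.exists_freeLift_faces_eq_boundary

end DGDMod

end Resolution

theorem theoremL_general {k : Type v} [Field k] [CharZero k] {O : Type u} [CommRing O]
    [Algebra k O] [Module.Finite O Ω[O⁄k]] [Module.Projective O Ω[O⁄k]] (A : DGDAlg k O)
    (C : DGDMod A) : IsCofibrant C ↔ ∃ S : DGDMod A, S.IsSullivan ∧ Nonempty (Retract C S) := by
  rw [DGDMod.isCofibrant_iff_exists_lift]
  constructor
  · intro hC
    obtain ⟨l, hl⟩ := hC C.augmentation C.liftsDisks_augmentation (𝟙 C)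
    exact ⟨C.sullivanResolution, C.isSullivan_sullivanResolution, ⟨⟨l, C.augmentation, hl⟩⟩⟩
  · rintro ⟨S, hS, ⟨r⟩⟩ X Y p hp g
    obtain ⟨l, hl⟩ := hS.exists_lift hp (r.r ≫ g)
    exact ⟨r.i ≫ l, by rw [Category.assoc, hl, r.retract_assoc]⟩

theorem theoremL {k : Type v} [Field k] [IsAlgClosed k] [CharZero k]
    {O : Type u} [CommRing O] [Algebra k O] [Algebra.Smooth k O]
    (A : DGDAlg k O) (C : DGDMod A) :
    IsCofibrant C ↔ ∃ S : DGDMod A, S.IsSullivan ∧ Nonempty (Retract C S) :=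
  theoremL_general A C
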